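/- For a structure $\mathbb{A}$ of a finite relational signature, let $FO(\mathbb{A})$ denote the set of (Gödel numbers of) the first-order sentences with equality of that signature that are true in $\mathbb{A}$. Let $\mathbf{\Sigma}^0_1(\mathbb{R}^n)$ be the lattice of all open subsets of $\mathbb{R}^n$, regarded as a structure of signature $\{\subseteq\}$, and let $\mathbb{N}_2=(\omega\cup P(\omega);\omega,P(\omega),\in,+,\times)$ be the structure of second-order arithmetic: its universe is the disjoint union of the set $\omega$ of natural numbers and the set $P(\omega)$ of all sets of natural numbers, with unary predicates for $\omega$ and $P(\omega)$, the membership relation between numbers and sets, and the graphs of addition and multiplication on $\omega$. Sets $A,B\subseteq\omega$ are $m$-equivalent, $A\equiv_m B$, if there are total computable functions $f,g:\omega\to\omega$ such that for all $k\in\omega$: $k\in A\iff f(k)\in B$, and $k\in B\iff g(k)\in A$. Theorem. For every $n\ge 2$, $FO(\mathbf{\Sigma}^0_1(\mathbb{R}^n))\equiv_m FO(\mathbb{N}_2)$. -/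

import Mathlib

namespace OpenSetTheory

/-! ### The first-order theory of a structure, as a set of Gödel numbers

Formulas are Mathlib's bounded first-order formulas (with equality) of a relational language. In
`L.BoundedFormula Empty n` the variables are `x_0, …, x_{n-1}`, and `all` binds `x_n` in a formula
of `L.BoundedFormula Empty (n + 1)`. -/

/-- The index of the variable that a term of a relational language consists of. -/
def varIndex {L : FirstOrder.Language.{0, 0}} [L.IsRelational] {n : ℕ} :
    L.Term (Empty ⊕ Fin n) → ℕ
  | .var (.inl e) => e.elim
  | .var (.inr i) => i
  | .func f _ => isEmptyElim f

/-- The Gödel number of a formula, by recursion on the formula, relative to a numbering `s` of the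
relation symbols. Every node of the formula is stored as the triple of the number `n` of its
available variables, a tag for the kind of the node, and the codes of its constituents. -/
def godelNumber {L : FirstOrder.Language.{0, 0}} [L.IsRelational] (s : ∀ l, L.Relations l → ℕ) :
    ∀ {n : ℕ}, L.BoundedFormula Empty n → ℕ
  | n, .falsum => Nat.pair n (Nat.pair 0 0)
  | n, .equal t u => Nat.pair n (Nat.pair 1 (Nat.pair (varIndex t) (varIndex u)))
  | n, .rel (l := l) R ts => Nat.pair n (Nat.pair 2
      (Nat.pair (s l R) (Encodable.encode (List.ofFn fun i => varIndex (ts i)))))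
  | n, .imp φ ψ => Nat.pair n (Nat.pair 3 (Nat.pair (godelNumber s φ) (godelNumber s ψ)))
  | n, .all φ => Nat.pair n (Nat.pair 4 (godelNumber s φ))

/-- `FO(A)`: the set of (Gödel numbers of) the first-order `L`-sentences that are true in `A`. -/
def FO (L : FirstOrder.Language.{0, 0}) [L.IsRelational] (s : ∀ l, L.Relations l → ℕ)
    (A : Type) [L.Structure A] : Set ℕ :=
  {k | ∃ φ : L.Sentence, φ ∈ L.completeTheory A ∧ godelNumber s φ = k}

theorem varIndex_injective {L : FirstOrder.Language.{0, 0}} [L.IsRelational] {n : ℕ} :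
    Function.Injective (varIndex : L.Term (Empty ⊕ Fin n) → ℕ) := by
  rintro ((e | i) | ⟨f, _⟩) ((e' | j) | ⟨g, _⟩) h
  all_goals first
    | exact e.elim
    | exact e'.elim
    | exact isEmptyElim f
    | exact isEmptyElim g
    | skip
  have h' : i = j := Fin.ext h
  rw [h']

/-- Distinct formulas have distinct Gödel numbers if distinct symbols have distinct numbers. -/
theorem godelNumber_injective {L : FirstOrder.Language.{0, 0}} [L.IsRelational]
    (s : ∀ l, L.Relations l → ℕ) (hs : ∀ l, Function.Injective (s l)) {n : ℕ} :
    Function.Injective (godelNumber s : L.BoundedFormula Empty n → ℕ) := by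
  intro φ
  induction φ with
  | falsum => intro ψ h; cases ψ <;> simp [godelNumber] at h ⊢
  | equal t u =>
    intro ψ h
    cases ψ <;> simp [godelNumber] at h ⊢
    exact ⟨varIndex_injective h.1, varIndex_injective h.2⟩
  | @rel n l R ts =>
    intro ψ h
    cases ψ with
    | @rel _ l' R' ts' =>
      simp only [godelNumber, Nat.pair_eq_pair, true_and, Encodable.encode_inj] at h
      obtain ⟨h1, h2⟩ := h
      have hl : l = l' := by simpa using congrArg List.length h2
      subst hl
      obtain rfl := hs _ h1
      have h3 := List.ofFn_injective h2
      congr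
      funext i
      exact varIndex_injective (congrFun h3 i)
    | _ => simp [godelNumber] at h
  | imp φ₁ φ₂ ih₁ ih₂ =>
    intro ψ h
    cases ψ <;> simp [godelNumber] at h ⊢
    exact ⟨ih₁ h.1, ih₂ h.2⟩
  | all φ ih =>
    intro ψ h
    cases ψ <;> simp [godelNumber] at h ⊢
    exact ih h

/-! ### The lattice of open sets -/

/-- The numbering of the only symbol `≤` of the language of orders. -/
def orderSymbolNumber : ∀ l, FirstOrder.Language.order.Relations l → ℕ
  | _, .le => 0

/-- `FO` of the lattice of all open subsets of a space `X`, in the signature `{⊆}`. -/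
def FOOpens (X : Type) [TopologicalSpace X] : Set ℕ :=
  letI : FirstOrder.Language.order.Structure (TopologicalSpace.Opens X) :=
    FirstOrder.Language.orderStructure (TopologicalSpace.Opens X)
  FO FirstOrder.Language.order orderSymbolNumber (TopologicalSpace.Opens X)

/-! ### Second-order arithmetic -/

/-- The relation symbols of second-order arithmetic: unary predicates for the numbers and for the
sets of numbers, membership, and the graphs of addition and multiplication. -/
inductive ArithRel : ℕ → Type
  | isNumber : ArithRel 1
  | isSet : ArithRel 1
  | mem : ArithRel 2
  | add : ArithRel 3
  | mul : ArithRel 3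

/-- The relational language of second-order arithmetic. -/
def arithLanguage : FirstOrder.Language.{0, 0} := ⟨fun _ => Empty, ArithRel⟩

instance : arithLanguage.IsRelational := fun _ => inferInstanceAs (IsEmpty Empty)

/-- The numbering of the symbols of second-order arithmetic. -/
def arithSymbolNumber : ∀ l, arithLanguage.Relations l → ℕ
  | _, ArithRel.isNumber => 0
  | _, ArithRel.isSet => 1
  | _, ArithRel.mem => 2
  | _, ArithRel.add => 3
  | _, ArithRel.mul => 4

/-- The universe of `ℕ₂`: the disjoint union of `ω` and `P(ω)`. -/
abbrev NatOrSet : Type := ℕ ⊕ Set ℕ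

/-- The structure `ℕ₂ = (ω ∪ P(ω); ω, P(ω), ∈, +, ×)`. -/
instance : arithLanguage.Structure NatOrSet where
  funMap f := Empty.elim f
  RelMap R x := match R with
    | ArithRel.isNumber => ∃ a : ℕ, x 0 = .inl a
    | ArithRel.isSet => ∃ S : Set ℕ, x 0 = .inr S
    | ArithRel.mem => ∃ (a : ℕ) (S : Set ℕ), x 0 = .inl a ∧ x 1 = .inr S ∧ a ∈ S
    | ArithRel.add => ∃ a b : ℕ, x 0 = .inl a ∧ x 1 = .inl b ∧ x 2 = .inl (a + b)
    | ArithRel.mul => ∃ a b : ℕ, x 0 = .inl a ∧ x 1 = .inl b ∧ x 2 = .inl (a * b)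

/-- `FO(ℕ₂)`: second-order arithmetic. -/
def FOArith : Set ℕ := FO arithLanguage arithSymbolNumber NatOrSet

theorem arithSymbolNumber_injective (l : ℕ) : Function.Injective (arithSymbolNumber l) := by
  intro R S h
  cases R <;> cases S <;> first | rfl | simp [arithSymbolNumber] at h

end OpenSetTheory

/-! Each reduction interprets one structure in the other. Suppose that the elements of `B` name
those of `A` through a surjection, and that equality and the relations of `A`, pulled back to `B`,
are definable from parameters `p`. Then a sentence `φ` about `A` becomes a formula `φ^p` about `B`.
If a nonempty definable set `Φ` consists of parameters that all work, then `φ` holds in `A` iff `∀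
p, Φ p → φ^p` holds in `B`. On Gödel numbers this translation is primitive recursive, which gives
`FO_manyOneReducible`.

Open sets in arithmetic: the rational boxes form a countable base, so a set of numbers names the
union of the boxes with these numbers. A point is a tuple of Dedekind cuts, hence again coded by a
set of numbers. Inclusion of two unions is a statement about all points, so it is expressible with a
set quantifier (`boxUnion_le_iff`).

Arithmetic in open sets: points are visible as coatoms, and connectedness is expressible. Choose two
coordinates and take the points whose coordinates there are natural numbers and whose other
coordinates vanish. This grid is closed and discrete, so each of its subsets is the trace of an open
set. The diagonal point `(k, k)` stands for the number `k`. Strips around the integral hyperplanes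
in each of the two coordinates have components that link the grid point `(k, l)` to `(k, k)` and to
`(l, l)`. Thus a grid point is a pair of numbers, and an open set codes a binary relation on
numbers.

With quantification over sets and binary relations, the Peano axioms are categorical, and addition
and multiplication are definable by recursion. The lattice formula cannot name the concrete grid; it
only states the conditions `IsGrid` and `IsPeano` on six parameters. These suffice in every complete
lattice (`exists_interpretation`), and the concrete grid shows that they are satisfiable
(`exists_isGrid_isPeano`). -/

namespace OpenSetTheory

open FirstOrder FirstOrder.Language TopologicalSpace

/-! ### Renaming variables, semantically and on Gödel numbers -/

section Renaming

variable {L : FirstOrder.Language.{0, 0}}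

/-- Simultaneous replacement of the variables of a formula by variables. -/
def renameVars : ∀ {k : ℕ}, L.BoundedFormula Empty k → ∀ {N : ℕ}, (Fin k → Fin N) →
    L.BoundedFormula Empty N
  | _, .falsum, _, _ => .falsum
  | _, .equal t u, _, f => .equal (t.relabel (Sum.map id f)) (u.relabel (Sum.map id f))
  | _, .rel R ts, _, f => .rel R fun i => (ts i).relabel (Sum.map id f)
  | _, .imp φ ψ, _, f => .imp (renameVars φ f) (renameVars ψ f)
  | _, .all φ, N, f =>
    .all (renameVars φ (N := N + 1) (Fin.snoc (fun i => (f i).castSucc) (Fin.last N)))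

theorem realize_relabel_map {M : Type} [L.Structure M] {k N : ℕ} (t : L.Term (Empty ⊕ Fin k))
    (f : Fin k → Fin N) (v : Fin N → M) :
    (t.relabel (Sum.map id f)).realize (Sum.elim (default : Empty → M) v) =
      t.realize (Sum.elim default (v ∘ f)) := by
  rw [Term.realize_relabel]
  congr 1
  funext x
  rcases x with e | i
  · exact e.elim
  · rfl

theorem realize_renameVars {M : Type} [L.Structure M] {k : ℕ} (φ : L.BoundedFormula Empty k) :
    ∀ {N : ℕ} (f : Fin k → Fin N) (v : Fin N → M),
      (renameVars φ f).Realize default v ↔ φ.Realize default (v ∘ f) := by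
  induction φ with
  | falsum => intro N f v; rfl
  | equal t u =>
    intro N f v
    simp only [renameVars, BoundedFormula.Realize, realize_relabel_map]
  | rel R ts =>
    intro N f v
    simp only [renameVars, BoundedFormula.Realize, realize_relabel_map]
  | imp φ ψ ihφ ihψ =>
    intro N f v
    simp only [renameVars, BoundedFormula.realize_imp, ihφ, ihψ]
  | all φ ih =>
    intro N f v
    simp only [renameVars, BoundedFormula.realize_all, ih]
    refine forall_congr' fun a => ?_
    have : (Fin.snoc v a : Fin (N + 1) → M) ∘
        (Fin.snoc (fun i => (f i).castSucc) (Fin.last N) : Fin (_ + 1) → Fin (N + 1)) =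
        Fin.snoc (v ∘ f) a := by
      funext i
      refine Fin.lastCases ?_ (fun i => ?_) i <;> simp
    rw [this]

variable [L.IsRelational] (s : ∀ l, L.Relations l → ℕ)

/-- The variable that a term of a relational language consists of. -/
def varFin {n : ℕ} : L.Term (Empty ⊕ Fin n) → Fin n
  | .var (.inl e) => e.elim
  | .var (.inr i) => i
  | .func f _ => isEmptyElim f

theorem coe_varFin {n : ℕ} (t : L.Term (Empty ⊕ Fin n)) : (varFin t : ℕ) = varIndex t := by
  rcases t with (e | i) | ⟨f, _⟩
  · exact e.elim
  · rfl
  · exact isEmptyElim f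

theorem realize_eq_varFin {M : Type} [L.Structure M] {n : ℕ} (t : L.Term (Empty ⊕ Fin n))
    (v : Fin n → M) : t.realize (Sum.elim (default : Empty → M) v) = v (varFin t) := by
  rcases t with (e | i) | ⟨f, _⟩
  · exact e.elim
  · rfl
  · exact isEmptyElim f

/-- The Gödel number of the formula that is obtained from a formula by replacing its variables
by those with the indices in a list, with `N` available variables. -/
def renamedCode : ∀ {k : ℕ}, L.BoundedFormula Empty k → ℕ → List ℕ → ℕ
  | _, .falsum, N, _ => Nat.pair N (Nat.pair 0 0)
  | _, .equal t u, N, is =>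
    Nat.pair N (Nat.pair 1 (Nat.pair (is.getD (varIndex t) 0) (is.getD (varIndex u) 0)))
  | _, .rel (l := l) R ts, N, is => Nat.pair N (Nat.pair 2
      (Nat.pair (s l R) (Encodable.encode (List.ofFn fun i => is.getD (varIndex (ts i)) 0))))
  | _, .imp φ ψ, N, is =>
    Nat.pair N (Nat.pair 3 (Nat.pair (renamedCode φ N is) (renamedCode ψ N is)))
  | _, .all φ, N, is => Nat.pair N (Nat.pair 4 (renamedCode φ (N + 1) (is ++ [N])))

theorem varIndex_relabel {k N : ℕ} (t : L.Term (Empty ⊕ Fin k)) (f : Fin k → Fin N) :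
    varIndex (t.relabel (Sum.map id f)) =
      (List.ofFn fun i => (f i : ℕ)).getD (varIndex t) 0 := by
  rcases t with (e | i) | ⟨f, _⟩
  · exact e.elim
  · simp [Term.relabel, varIndex]
  · exact isEmptyElim f

/-- The code of a renamed formula depends only on the number of available variables and the list of
new indices. These vary with the input of the reduction, whereas `φ` is one of finitely many fixed
defining formulas. -/
theorem godelNumber_renameVars {k : ℕ} (φ : L.BoundedFormula Empty k) :
    ∀ {N : ℕ} (f : Fin k → Fin N),
      godelNumber s (renameVars φ f) = renamedCode s φ N (List.ofFn fun i => (f i : ℕ)) := by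
  induction φ with
  | falsum => intro N f; rfl
  | equal t u =>
    intro N f
    simp only [renameVars, godelNumber, renamedCode, varIndex_relabel]
  | rel R ts =>
    intro N f
    simp only [renameVars, godelNumber, renamedCode, varIndex_relabel]
  | imp φ ψ ihφ ihψ =>
    intro N f
    simp only [renameVars, godelNumber, renamedCode, ihφ, ihψ]
  | all φ ih =>
    intro N f
    simp only [renameVars, godelNumber, renamedCode, ih]
    congr 4
    rw [List.ofFn_succ_last]
    simp

/-- The recursion is on the fixed formula `φ`, outside the computation, so a plain induction
composes finitely many primitive recursive functions. -/
theorem primrec_renamedCode {k : ℕ} (φ : L.BoundedFormula Empty k) :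
    Primrec₂ (renamedCode s φ) := by
  induction φ with
  | falsum =>
    change Primrec fun p : ℕ × List ℕ => Nat.pair p.1 (Nat.pair 0 0)
    exact Primrec₂.natPair.comp Primrec.fst (Primrec.const _)
  | equal t u =>
    change Primrec fun p : ℕ × List ℕ => Nat.pair p.1 (Nat.pair 1
      (Nat.pair (p.2.getD (varIndex t) 0) (p.2.getD (varIndex u) 0)))
    exact Primrec₂.natPair.comp Primrec.fst (Primrec₂.natPair.comp (Primrec.const _)
      (Primrec₂.natPair.comp ((Primrec.list_getD 0).comp Primrec.snd (Primrec.const _))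
        ((Primrec.list_getD 0).comp Primrec.snd (Primrec.const _))))
  | @rel _ l R ts =>
    change Primrec fun p : ℕ × List ℕ => Nat.pair p.1 (Nat.pair 2 (Nat.pair (s l R)
      (Encodable.encode (List.ofFn fun i => p.2.getD (varIndex (ts i)) 0))))
    exact Primrec₂.natPair.comp Primrec.fst (Primrec₂.natPair.comp (Primrec.const _)
      (Primrec₂.natPair.comp (Primrec.const _) (Primrec.encode.comp (Primrec.list_ofFn fun i =>
      (Primrec.list_getD 0).comp Primrec.snd (Primrec.const _)))))
  | imp φ ψ ihφ ihψ =>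
    change Primrec fun p : ℕ × List ℕ => Nat.pair p.1 (Nat.pair 3
      (Nat.pair (renamedCode s φ p.1 p.2) (renamedCode s ψ p.1 p.2)))
    exact Primrec₂.natPair.comp Primrec.fst (Primrec₂.natPair.comp (Primrec.const _)
      (Primrec₂.natPair.comp ihφ ihψ))
  | all φ ih =>
    change Primrec fun p : ℕ × List ℕ => Nat.pair p.1 (Nat.pair 4
      (renamedCode s φ (p.1 + 1) (p.2 ++ [p.1])))
    exact Primrec₂.natPair.comp Primrec.fst (Primrec₂.natPair.comp (Primrec.const _)
      (ih.comp (Primrec.succ.comp Primrec.fst) (Primrec.list_append.comp Primrec.snd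
      (Primrec.list_cons.comp Primrec.fst (Primrec.const [])))))

end Renaming

/-! ### Translation along an interpretation, and its primitive recursive version on codes -/

section Translation

variable {L L' : FirstOrder.Language.{0, 0}} [L.IsRelational] {m : ℕ}
  (E : L'.BoundedFormula Empty (m + 2)) (ρ : ∀ l, L.Relations l → L'.BoundedFormula Empty (m + l))

/-- The list of `m` parameters, followed by given variables. -/
def withParams {n l : ℕ} (f : Fin l → Fin n) : Fin (m + l) → Fin (m + n) :=
  Fin.append (Fin.castAdd n) fun i => Fin.natAdd m (f i)

theorem append_comp_withParams {M : Type} {n l : ℕ} (p : Fin m → M) (v : Fin n → M)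
    (f : Fin l → Fin n) : Fin.append p v ∘ withParams f = Fin.append p (v ∘ f) := by
  funext i
  refine Fin.addCases (fun i => ?_) (fun i => ?_) i <;> simp [withParams]

theorem ofFn_withParams {n l : ℕ} (f : Fin l → Fin n) :
    (List.ofFn fun i => (withParams (m := m) f i : ℕ)) =
      List.range m ++ (List.ofFn fun i => (f i : ℕ)).map (m + ·) := by
  apply List.ext_getElem
  · simp
  · intro i h₁ h₂
    simp only [List.length_ofFn] at h₁
    have hl (j : Fin m) : withParams f (Fin.castAdd l j) = Fin.castAdd n j := by simp [withParams]
    have hr (j : Fin l) : withParams f (Fin.natAdd m j) = Fin.natAdd m (f j) := by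
      simp [withParams]
    by_cases h : i < m
    · rw [List.getElem_ofFn]
      change ((withParams f (Fin.castAdd l ⟨i, h⟩) : Fin (m + n)) : ℕ) = _
      rw [hl]
      simp [h]
    · obtain ⟨j, rfl⟩ := Nat.exists_eq_add_of_le (not_lt.1 h)
      rw [List.getElem_ofFn]
      change ((withParams f (Fin.natAdd m ⟨j, by omega⟩) : Fin (m + n)) : ℕ) = _
      rw [hr]
      simp

/-- The translation of formulas given by an interpretation with `m` parameters. -/
def translate : ∀ {n : ℕ}, L.BoundedFormula Empty n → L'.BoundedFormula Empty (m + n)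
  | _, .falsum => .falsum
  | _, .equal t u => renameVars E (withParams ![varFin t, varFin u])
  | _, .rel R ts => renameVars (ρ _ R) (withParams fun i => varFin (ts i))
  | _, .imp φ ψ => .imp (translate φ) (translate ψ)
  | _, .all φ => .all (translate φ)

/-- Since `π` is surjective, every element of `B` names an element of `A` and every element of `A`
has a name, so quantifiers need no relativization. As the parameters occupy the first `m` variables,
a quantifier still binds the last variable after translation. -/
theorem realize_translate {A B : Type} [L.Structure A] [L'.Structure B] {p : Fin m → B}
    {π : B → A} (hπ : Function.Surjective π)
    (hE : ∀ x y, E.Realize default (Fin.append p ![x, y]) ↔ π x = π y)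
    (hρ : ∀ l (R : L.Relations l) xs,
      (ρ l R).Realize default (Fin.append p xs) ↔ Structure.RelMap R (π ∘ xs))
    {n : ℕ} (φ : L.BoundedFormula Empty n) :
    ∀ v : Fin n → B, (translate E ρ φ).Realize default (Fin.append p v) ↔
      φ.Realize default (π ∘ v) := by
  induction φ with
  | falsum => intro v; rfl
  | equal t u =>
    intro v
    have : v ∘ ![varFin t, varFin u] = ![v (varFin t), v (varFin u)] := by
      funext i; fin_cases i <;> rfl
    simp only [translate, realize_renameVars, append_comp_withParams, this, hE]
    simp only [BoundedFormula.Realize, realize_eq_varFin, Function.comp_apply]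
  | rel R ts =>
    intro v
    simp only [translate, realize_renameVars, append_comp_withParams, hρ]
    simp only [BoundedFormula.Realize, realize_eq_varFin, Function.comp_def]
  | imp φ ψ ihφ ihψ =>
    intro v
    simp only [translate, BoundedFormula.realize_imp, ihφ, ihψ]
  | all φ ih =>
    intro v
    simp only [translate, BoundedFormula.realize_all]
    rw [hπ.forall]
    refine forall_congr' fun b => ?_
    have : (Fin.snoc (π ∘ v) (π b) : Fin (_ + 1) → A) = π ∘ (Fin.snoc v b) := by
      rw [Fin.comp_snoc]
    rw [this, ← ih, Fin.append_snoc]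

variable [L'.IsRelational] (s : ∀ l, L.Relations l → ℕ) (s' : ∀ l, L'.Relations l → ℕ)

/-- The Gödel number of the translation of an atomic formula, where the relation symbol with
number `c` is looked up in a list. -/
def translateRel (n c : ℕ) (is : List ℕ) : List (Σ l, L.Relations l) → Option ℕ
  | [] => none
  | R :: Rs => if s R.1 R.2 = c ∧ is.length = R.1 ∧ ∀ i ∈ is, i < n then
      some (renamedCode s' (ρ R.1 R.2) (m + n) (List.range m ++ is.map (m + ·)))
    else translateRel n c is Rs

/-- One step of the translation on Gödel numbers: the translation of `k`, given the translations
of smaller numbers; numbers that are not Gödel numbers of formulas are rejected. -/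
def translateNode (Rs : List (Σ l, L.Relations l)) (ih : ℕ → Option ℕ) (k : ℕ) : Option ℕ :=
  if k.unpair.2.unpair.1 = 0 then
    if k.unpair.2.unpair.2 = 0 then some (Nat.pair (m + k.unpair.1) (Nat.pair 0 0)) else none
  else if k.unpair.2.unpair.1 = 1 then
    if k.unpair.2.unpair.2.unpair.1 < k.unpair.1 ∧ k.unpair.2.unpair.2.unpair.2 < k.unpair.1 then
      some (renamedCode s' E (m + k.unpair.1) (List.range m ++
        [m + k.unpair.2.unpair.2.unpair.1, m + k.unpair.2.unpair.2.unpair.2]))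
    else none
  else if k.unpair.2.unpair.1 = 2 then
    (Encodable.decode (α := List ℕ) k.unpair.2.unpair.2.unpair.2).bind fun is =>
      translateRel ρ s s' k.unpair.1 k.unpair.2.unpair.2.unpair.1 is Rs
  else if k.unpair.2.unpair.1 = 3 then
    if k.unpair.2.unpair.2.unpair.1.unpair.1 = k.unpair.1 ∧
        k.unpair.2.unpair.2.unpair.2.unpair.1 = k.unpair.1 then
      (ih k.unpair.2.unpair.2.unpair.1).bind fun x =>
        (ih k.unpair.2.unpair.2.unpair.2).map fun y =>
          Nat.pair (m + k.unpair.1) (Nat.pair 3 (Nat.pair x y))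
    else none
  else if k.unpair.2.unpair.1 = 4 then
    if k.unpair.2.unpair.2.unpair.1 = k.unpair.1 + 1 then
      (ih k.unpair.2.unpair.2).map fun x => Nat.pair (m + k.unpair.1) (Nat.pair 4 x)
    else none
  else none

/-- The translation on Gödel numbers. -/
def translateCode (Rs : List (Σ l, L.Relations l)) (k : ℕ) : Option ℕ :=
  translateNode E ρ s s' Rs (fun j => if _h : j < k then translateCode Rs j else none) k
termination_by k

omit [L.IsRelational] in
theorem primrec_translateRel (Rs : List (Σ l, L.Relations l)) :
    Primrec fun p : (ℕ × ℕ) × List ℕ => translateRel ρ s s' p.1.1 p.1.2 p.2 Rs := by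
  induction Rs with
  | nil => exact Primrec.const none
  | cons R Rs ih =>
    simp only [translateRel]
    refine Primrec.ite ?_ ?_ ih
    · refine .and ?_ (.and ?_ ?_)
      · exact Primrec.eq.comp (Primrec.const _) (Primrec.snd.comp Primrec.fst)
      · exact Primrec.eq.comp (Primrec.list_length.comp Primrec.snd) (Primrec.const _)
      · exact (PrimrecRel.forall_mem_list Primrec.nat_lt).comp Primrec.snd
          (Primrec.fst.comp Primrec.fst)
    · refine Primrec.option_some.comp ((primrec_renamedCode s' _).comp
        (Primrec.nat_add.comp (Primrec.const m) (Primrec.fst.comp Primrec.fst))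
        (Primrec.list_append.comp (Primrec.const _) (Primrec.list_map Primrec.snd ?_)))
      exact (Primrec.nat_add.comp (Primrec.const m) Primrec.snd).to₂

omit [L.IsRelational] in
theorem primrec_translateNode (Rs : List (Σ l, L.Relations l)) {α : Type} [Primcodable α]
    {ih : α → ℕ → Option ℕ} (hih : Primrec₂ ih) {k : α → ℕ} (hk : Primrec k) :
    Primrec fun a => translateNode E ρ s s' Rs (ih a) (k a) := by
  have h₁ : Primrec fun a => (k a).unpair.1 := Primrec.fst.comp (Primrec.unpair.comp hk)
  have h₂ : Primrec fun a => (k a).unpair.2 := Primrec.snd.comp (Primrec.unpair.comp hk)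
  have htag : Primrec fun a => (k a).unpair.2.unpair.1 :=
    Primrec.fst.comp (Primrec.unpair.comp h₂)
  have h : Primrec fun a => (k a).unpair.2.unpair.2 := Primrec.snd.comp (Primrec.unpair.comp h₂)
  have hl : Primrec fun a => (k a).unpair.2.unpair.2.unpair.1 :=
    Primrec.fst.comp (Primrec.unpair.comp h)
  have hr : Primrec fun a => (k a).unpair.2.unpair.2.unpair.2 :=
    Primrec.snd.comp (Primrec.unpair.comp h)
  have hm : Primrec fun a => m + (k a).unpair.1 := Primrec.nat_add.comp (Primrec.const m) h₁
  unfold translateNode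
  refine Primrec.ite (Primrec.eq.comp htag (Primrec.const _)) ?_ <|
    Primrec.ite (Primrec.eq.comp htag (Primrec.const _)) ?_ <|
    Primrec.ite (Primrec.eq.comp htag (Primrec.const _)) ?_ <|
    Primrec.ite (Primrec.eq.comp htag (Primrec.const _)) ?_ <|
    Primrec.ite (Primrec.eq.comp htag (Primrec.const _)) ?_ (Primrec.const none)
  · exact Primrec.ite (Primrec.eq.comp h (Primrec.const _))
      (Primrec.option_some.comp (Primrec₂.natPair.comp hm (Primrec.const _))) (Primrec.const none)
  · refine Primrec.ite (.and (Primrec.nat_lt.comp hl h₁) (Primrec.nat_lt.comp hr h₁))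
      (Primrec.option_some.comp ((primrec_renamedCode s' _).comp hm ?_)) (Primrec.const none)
    exact Primrec.list_append.comp (Primrec.const _) (Primrec.list_cons.comp
      (Primrec.nat_add.comp (Primrec.const m) hl) (Primrec.list_cons.comp
      (Primrec.nat_add.comp (Primrec.const m) hr) (Primrec.const [])))
  · refine Primrec.option_bind (Primrec.decode.comp hr) ?_
    exact (primrec_translateRel ρ s s' Rs).comp (Primrec.pair (Primrec.pair
      (h₁.comp Primrec.fst) (hl.comp Primrec.fst)) Primrec.snd)
  · refine Primrec.ite (.and
      (Primrec.eq.comp (Primrec.fst.comp (Primrec.unpair.comp hl)) h₁)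
      (Primrec.eq.comp (Primrec.fst.comp (Primrec.unpair.comp hr)) h₁)) ?_ (Primrec.const none)
    refine Primrec.option_bind (hih.comp Primrec.id hl) ?_
    refine Primrec.option_map ((hih.comp Primrec.id hr).comp Primrec.fst) ?_
    exact Primrec₂.natPair.comp (hm.comp (Primrec.fst.comp Primrec.fst))
      (Primrec₂.natPair.comp (Primrec.const _)
        (Primrec₂.natPair.comp (Primrec.snd.comp Primrec.fst) Primrec.snd))
  · refine Primrec.ite (Primrec.eq.comp (Primrec.fst.comp (Primrec.unpair.comp h))
      (Primrec.succ.comp h₁)) ?_ (Primrec.const none)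
    refine Primrec.option_map (hih.comp Primrec.id h) ?_
    exact Primrec₂.natPair.comp (hm.comp Primrec.fst)
      (Primrec₂.natPair.comp (Primrec.const _) Primrec.snd)

omit [L.IsRelational] in
theorem primrec_translateCode (Rs : List (Σ l, L.Relations l)) :
    Primrec (translateCode E ρ s s' Rs) := by
  have key : Primrec₂ fun (_ : Unit) k => translateCode E ρ s s' Rs k := by
    -- Course-of-values recursion: the list holds the translations of all smaller numbers, and its
    -- length is the current number.
    refine Primrec.nat_strong_rec _ (g := fun _ l => some
      (translateNode E ρ s s' Rs (fun j => l.getD j none) l.length)) ?_ ?_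
    · exact Primrec.option_some.comp (primrec_translateNode E ρ s s' Rs
        (ih := fun (q : Unit × List (Option ℕ)) j => q.2.getD j none)
        ((Primrec.list_getD none).comp (Primrec.snd.comp Primrec.fst) Primrec.snd)
        (Primrec.list_length.comp Primrec.snd))
    · intro _ k
      conv_rhs => rw [translateCode]
      congr 2
      · funext j
        by_cases hj : j < k <;> simp [List.getD_eq_getElem?_getD, hj]
      · simp
  exact key.comp (Primrec.const ()) Primrec.id

end Translation

/-! ### Correctness of the translation on codes -/

section TranslationCorrect

variable {L L' : FirstOrder.Language.{0, 0}} [L.IsRelational] [L'.IsRelational] {m : ℕ}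
  (E : L'.BoundedFormula Empty (m + 2)) (ρ : ∀ l, L.Relations l → L'.BoundedFormula Empty (m + l))
  (s : ∀ l, L.Relations l → ℕ) (s' : ∀ l, L'.Relations l → ℕ)
  {Rs : List (Σ l, L.Relations l)}

omit [L.IsRelational] in
theorem translateRel_of_mem (hs : ∀ l, Function.Injective (s l)) {l n : ℕ} (R : L.Relations l)
    (f : Fin l → Fin n) (hR : ⟨l, R⟩ ∈ Rs) :
    translateRel ρ s s' n (s l R) (List.ofFn fun i => (f i : ℕ)) Rs =
      some (godelNumber s' (renameVars (ρ l R) (withParams f))) := by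
  induction Rs with
  | nil => simp at hR
  | cons Q Rs ih =>
    rw [translateRel]
    split_ifs with h
    · obtain ⟨l', Q⟩ := Q
      obtain ⟨h₁, h₂, -⟩ := h
      simp only [List.length_ofFn] at h₂
      subst h₂
      obtain rfl := hs _ h₁
      rw [godelNumber_renameVars, ofFn_withParams]
    · refine ih ((List.mem_cons.1 hR).resolve_left ?_)
      rintro rfl
      refine h ⟨rfl, by simp, ?_⟩
      simp

omit [L.IsRelational] in
theorem exists_of_translateRel {n c d : ℕ} {is : List ℕ}
    (h : translateRel ρ s s' n c is Rs = some d) :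
    ∃ (l : ℕ) (R : L.Relations l) (f : Fin l → Fin n),
      s l R = c ∧ (List.ofFn fun i => (f i : ℕ)) = is := by
  induction Rs with
  | nil => simp [translateRel] at h
  | cons Q Rs ih =>
    rw [translateRel] at h
    split_ifs at h with h'
    · obtain ⟨h₁, h₂, h₃⟩ := h'
      refine ⟨Q.1, Q.2, fun i => ⟨is[(i : ℕ)]'(h₂.symm ▸ i.2), h₃ _ (List.getElem_mem _)⟩, h₁, ?_⟩
      apply List.ext_getElem <;> simp [h₂]
    · exact ih h

theorem unpair_unpair_lt {k : ℕ} (h : k.unpair.2.unpair.1 ≠ 0) : k.unpair.2.unpair.2 < k := by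
  have h₁ := Nat.unpair_add_le k
  have h₂ := Nat.unpair_add_le k.unpair.2
  omega

-- The guard in the recursion is harmless: recursive calls occur only under the nonzero tags 3 and
-- 4, where the constituents have strictly smaller codes.
omit [L.IsRelational] in
theorem translateCode_eq (k : ℕ) :
    translateCode E ρ s s' Rs k = translateNode E ρ s s' Rs (translateCode E ρ s s' Rs) k := by
  rw [translateCode]
  unfold translateNode
  split_ifs with h₁ h₂ h₃ h₄ h₅ h₆ h₇ h₈ h₉
  all_goals try rfl
  · have h := unpair_unpair_lt h₁
    beta_reduce
    rw [dif_pos ((Nat.unpair_left_le _).trans_lt h), dif_pos ((Nat.unpair_right_le _).trans_lt h)]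
  · beta_reduce
    rw [dif_pos (unpair_unpair_lt h₁)]

theorem unpair_godelNumber {n : ℕ} (φ : L.BoundedFormula Empty n) :
    (godelNumber s φ).unpair.1 = n := by
  cases φ <;> simp [godelNumber]

theorem translateCode_godelNumber (hs : ∀ l, Function.Injective (s l)) (hRs : ∀ R, R ∈ Rs) {n : ℕ}
    (φ : L.BoundedFormula Empty n) :
    translateCode E ρ s s' Rs (godelNumber s φ) = some (godelNumber s' (translate E ρ φ)) := by
  induction φ with
  | falsum => simp [translateCode_eq, translateNode, godelNumber, translate]
  | @equal n t u =>
    have : (List.ofFn fun i => (withParams (m := m) ![varFin t, varFin u] i : ℕ)) =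
        List.range m ++ [m + varIndex t, m + varIndex u] := by
      rw [ofFn_withParams]
      simp [List.ofFn_succ, coe_varFin]
    have ht : varIndex t < n := by rw [← coe_varFin]; exact Fin.is_lt _
    have hu : varIndex u < n := by rw [← coe_varFin]; exact Fin.is_lt _
    rw [translate, godelNumber_renameVars, this]
    simp [translateCode_eq, translateNode, godelNumber, ht, hu]
  | @rel n l R ts =>
    have := translateRel_of_mem ρ s s' hs R (fun i => varFin (ts i)) (hRs _)
    simp only [coe_varFin] at this
    simp [translateCode_eq, translateNode, godelNumber, translate, this]
  | imp φ ψ ihφ ihψ =>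
    rw [translateCode_eq]
    simp [translateNode, godelNumber, translate, ihφ, ihψ, unpair_godelNumber]
  | all φ ih =>
    rw [translateCode_eq]
    simp [translateNode, godelNumber, translate, ih, unpair_godelNumber]

/-- The converse of `translateCode_godelNumber`: only Gödel numbers are accepted. The reduction
needs this to send every other number outside the target theory. -/
theorem exists_godelNumber_of_translateCode (k : ℕ) :
    ∀ {n c : ℕ}, translateCode E ρ s s' Rs k = some c → k.unpair.1 = n →
      ∃ φ : L.BoundedFormula Empty n, godelNumber s φ = k := by
  induction k using Nat.strong_induction_on with
  | _ k ih =>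
    intro n c h hn
    have hk : Nat.pair n (Nat.pair k.unpair.2.unpair.1 k.unpair.2.unpair.2) = k := by
      rw [Nat.pair_unpair, ← hn, Nat.pair_unpair]
    rw [translateCode_eq, translateNode, hn] at h
    split_ifs at h with h₁ h₂ h₃ h₄ h₅ h₆ h₇ h₈ h₉
    · exact ⟨.falsum, by rw [← hk, h₁, h₂]; rfl⟩
    · refine ⟨.equal (.var (.inr ⟨_, h₄.1⟩)) (.var (.inr ⟨_, h₄.2⟩)), ?_⟩
      conv_rhs => rw [← hk, h₃]
      simp [godelNumber, varIndex]
    · simp only [Option.bind_eq_some_iff] at h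
      obtain ⟨is, h₆, h₇⟩ := h
      obtain ⟨l, R, f, h₈, h₉⟩ := exists_of_translateRel ρ s s' h₇
      refine ⟨.rel R fun i => .var (.inr (f i)), ?_⟩
      conv_rhs => rw [← hk, h₅]
      -- Every number codes exactly one list, so encoding the decoded argument list returns the
      -- number that was stored in `k`.
      have := (Denumerable.decode_eq_ofNat (List ℕ) k.unpair.2.unpair.2.unpair.2).symm.trans h₆
      simp only [Option.some.injEq] at this
      simp only [godelNumber, varIndex, h₈, h₉]
      rw [← this, Denumerable.encode_ofNat, Nat.pair_unpair]
    · simp only [Option.bind_eq_some_iff, Option.map_eq_some_iff] at h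
      obtain ⟨x, hx, y, hy, -⟩ := h
      have hlt := unpair_unpair_lt h₁
      obtain ⟨φ, hφ⟩ := ih _ ((Nat.unpair_left_le _).trans_lt hlt) hx h₇.1
      obtain ⟨ψ, hψ⟩ := ih _ ((Nat.unpair_right_le _).trans_lt hlt) hy h₇.2
      refine ⟨.imp φ ψ, ?_⟩
      conv_rhs => rw [← hk, h₆]
      simp [godelNumber, hφ, hψ]
    · simp only [Option.map_eq_some_iff] at h
      obtain ⟨x, hx, -⟩ := h
      obtain ⟨φ, hφ⟩ := ih _ (unpair_unpair_lt h₁) hx h₉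
      refine ⟨.all φ, ?_⟩
      conv_rhs => rw [← hk, h₈]
      simp [godelNumber, hφ]

/-- The Gödel number of the universal closure of a formula with `n` variables. -/
def allsCode : ℕ → ℕ → ℕ
  | 0, c => c
  | n + 1, c => allsCode n (Nat.pair n (Nat.pair 4 c))

theorem primrec_allsCode (n : ℕ) : Primrec (allsCode n) := by
  induction n with
  | zero => exact Primrec.id
  | succ n ih =>
    exact ih.comp (Primrec₂.natPair.comp (Primrec.const _)
      (Primrec₂.natPair.comp (Primrec.const _) Primrec.id))

theorem godelNumber_alls {n : ℕ} (φ : L.BoundedFormula Empty n) :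
    godelNumber s φ.alls = allsCode n (godelNumber s φ) := by
  induction n with
  | zero => rfl
  | succ n ih => exact ih φ.all

end TranslationCorrect

/-! ### From interpretations to many-one reductions -/

section Definability

/-- A relation on a structure is definable without parameters. -/
def IsDefinable (L : FirstOrder.Language.{0, 0}) {B : Type} [L.Structure B] {n : ℕ}
    (P : (Fin n → B) → Prop) : Prop :=
  ∃ φ : L.BoundedFormula Empty n, ∀ v, φ.Realize default v ↔ P v

/-- If a structure `A` has a one-dimensional interpretation with `m` parameters in `B` then the
theory of `A` is reducible to that of `B`. -/
theorem FO_manyOneReducible {L L' : FirstOrder.Language.{0, 0}} [L.IsRelational] [L'.IsRelational]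
    {s : ∀ l, L.Relations l → ℕ} {s' : ∀ l, L'.Relations l → ℕ}
    (hs : ∀ l, Function.Injective (s l)) (hs' : ∀ l, Function.Injective (s' l))
    (Rs : List (Σ l, L.Relations l)) (hRs : ∀ R, R ∈ Rs)
    {A B : Type} [L.Structure A] [L'.Structure B] {m : ℕ}
    {Φ : (Fin m → B) → Prop} (hΦ : IsDefinable L' Φ) {E : (Fin (m + 2) → B) → Prop}
    (hE : IsDefinable L' E) {ρ : ∀ l, L.Relations l → (Fin (m + l) → B) → Prop}
    (hρ : ∀ l R, IsDefinable L' (ρ l R)) (hex : ∃ p, Φ p)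
    (hπ : ∀ p, Φ p → ∃ π : B → A, Function.Surjective π ∧
      (∀ x y, E (Fin.append p ![x, y]) ↔ π x = π y) ∧
      ∀ l (R : L.Relations l) xs, ρ l R (Fin.append p xs) ↔ Structure.RelMap R (π ∘ xs)) :
    (fun k : ℕ => k ∈ FO L s A) ≤₀ (fun k : ℕ => k ∈ FO L' s' B) := by
  obtain ⟨Φ', hΦ⟩ := hΦ
  obtain ⟨E', hE⟩ := hE
  choose ρ' hρ using hρ
  -- The sentence `φ` goes to the universal closure of `Φ → φ^p`. The test of the first component
  -- selects sentences among formulas; all rejected inputs go to `0`.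
  let F : ℕ → ℕ := fun k => if k.unpair.1 = 0 then
    ((translateCode E' ρ' s s' Rs k).map fun c =>
      allsCode m (Nat.pair m (Nat.pair 3 (Nat.pair (godelNumber s' Φ') c)))).getD 0 else 0
  -- The default value `0` is the code of falsum, which is not a true sentence.
  have h0 : (0 : ℕ) ∉ FO L' s' B := by
    rintro ⟨φ, hφ, h⟩
    have h' : godelNumber s' (.falsum : L'.BoundedFormula Empty 0) = 0 := rfl
    obtain rfl := godelNumber_injective s' hs' (h.trans h'.symm)
    exact hφ
  refine ⟨F, Primrec.to_comp ?_, fun k => ?_⟩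
  · refine Primrec.ite (Primrec.eq.comp (Primrec.fst.comp Primrec.unpair) (Primrec.const 0))
      ?_ (Primrec.const 0)
    refine Primrec.option_getD.comp (Primrec.option_map (primrec_translateCode E' ρ' s s' Rs) ?_)
      (Primrec.const 0)
    exact (primrec_allsCode m).comp (Primrec₂.natPair.comp (Primrec.const _) (Primrec₂.natPair.comp
      (Primrec.const _) (Primrec₂.natPair.comp (Primrec.const _) Primrec.snd)))
  by_cases hk : ∃ φ : L.Sentence, godelNumber s φ = k
  · obtain ⟨φ, rfl⟩ := hk
    have hF : F (godelNumber s φ) =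
        godelNumber s' (BoundedFormula.alls (Φ'.imp (translate E' ρ' φ))) := by
      simp only [F, unpair_godelNumber, if_true, translateCode_godelNumber E' ρ' s s' hs hRs,
        godelNumber_alls]
      rfl
    have hmem {L : FirstOrder.Language.{0, 0}} [L.IsRelational] {s : ∀ l, L.Relations l → ℕ}
        (hs : ∀ l, Function.Injective (s l)) {A : Type} [L.Structure A] (φ : L.Sentence) :
        godelNumber s φ ∈ FO L s A ↔ BoundedFormula.Realize φ default (default : Fin 0 → A) := by
      constructor
      · rintro ⟨ψ, hψ, h⟩
        obtain rfl := godelNumber_injective s hs h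
        exact hψ
      · exact fun h => ⟨φ, h, rfl⟩
    rw [hF]
    refine Iff.trans (hmem hs φ) (Iff.trans ?_ (hmem hs' _).symm)
    change _ ↔ Formula.Realize _ _
    rw [BoundedFormula.realize_alls]
    -- All admissible parameters interpret the same `A`, so the truth of the translation does not
    -- depend on the choice of `p`; `hex` keeps the universal closure from being vacuous.
    have key : ∀ p, Φ p → ((translate E' ρ' φ).Realize default p ↔
        BoundedFormula.Realize φ default (default : Fin 0 → A)) := by
      intro p hp
      obtain ⟨π, hsurj, hE', hρ'⟩ := hπ p hp
      have := realize_translate E' ρ' hsurj (fun x y => (hE _).trans (hE' x y))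
        (fun l R xs => (hρ l R _).trans (hρ' l R xs)) φ default
      have hp' : Fin.append p (default : Fin 0 → B) = p := by
        funext i
        exact Fin.append_left p default i
      rw [hp'] at this
      rw [this]
      congr! 1
    constructor
    · intro h p
      rw [BoundedFormula.realize_imp, hΦ]
      exact fun hp => (key p hp).2 h
    · intro h
      obtain ⟨p, hp⟩ := hex
      have := h p
      rw [BoundedFormula.realize_imp, hΦ] at this
      exact (key p hp).1 (this hp)
  · have hF : F k = 0 := by
      by_contra hne
      simp only [F] at hne
      split_ifs at hne with h
      · rcases hc : translateCode E' ρ' s s' Rs k with _ | c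
        · simp [hc] at hne
        · exact hk (exists_godelNumber_of_translateCode E' ρ' s s' k hc h)
      · exact hne rfl
    rw [hF]
    refine iff_of_false (fun h => ?_) h0
    obtain ⟨φ, -, h⟩ := h
    exact hk ⟨φ, h⟩

end Definability

/-! ### Closure properties of definable relations -/

namespace IsDefinable

variable {L : FirstOrder.Language.{0, 0}} {B : Type} [L.Structure B] {n : ℕ}
  {P Q : (Fin n → B) → Prop}

theorem of_iff (hP : IsDefinable L P) (h : ∀ v, Q v ↔ P v) : IsDefinable L Q := by
  obtain ⟨φ, hφ⟩ := hP
  exact ⟨φ, fun v => (hφ v).trans (h v).symm⟩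

theorem eq (i j : Fin n) : IsDefinable L fun v : Fin n → B => v i = v j :=
  ⟨.equal (.var (.inr i)) (.var (.inr j)), fun _ => Iff.rfl⟩

theorem rel {l : ℕ} (R : L.Relations l) (f : Fin l → Fin n) :
    IsDefinable L fun v : Fin n → B => Structure.RelMap R fun i => v (f i) :=
  ⟨.rel R fun i => .var (.inr (f i)), fun _ => Iff.rfl⟩

theorem true : IsDefinable L fun _ : Fin n → B => True :=
  ⟨⊤, fun _ => iff_of_true (BoundedFormula.realize_top.2 trivial) trivial⟩

theorem imp (hP : IsDefinable L P) (hQ : IsDefinable L Q) : IsDefinable L fun v => P v → Q v := by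
  obtain ⟨φ, hφ⟩ := hP
  obtain ⟨ψ, hψ⟩ := hQ
  exact ⟨φ.imp ψ, fun v => by rw [BoundedFormula.realize_imp, hφ, hψ]⟩

theorem not (hP : IsDefinable L P) : IsDefinable L fun v => ¬P v := by
  obtain ⟨φ, hφ⟩ := hP
  exact ⟨φ.not, fun v => by rw [BoundedFormula.realize_not, hφ]⟩

theorem and (hP : IsDefinable L P) (hQ : IsDefinable L Q) : IsDefinable L fun v => P v ∧ Q v := by
  refine (hP.imp hQ.not).not.of_iff fun v => ?_
  tauto

theorem or (hP : IsDefinable L P) (hQ : IsDefinable L Q) : IsDefinable L fun v => P v ∨ Q v := by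
  refine (hP.not.imp hQ).of_iff fun v => ?_
  tauto

theorem iff (hP : IsDefinable L P) (hQ : IsDefinable L Q) :
    IsDefinable L fun v => (P v ↔ Q v) := by
  refine ((hP.imp hQ).and (hQ.imp hP)).of_iff fun v => ?_
  tauto

theorem all {P : (Fin n → B) → B → Prop}
    (hP : IsDefinable L fun v : Fin (n + 1) → B =>
      P (fun i => v i.castSucc) (v (Fin.last n))) :
    IsDefinable L fun v => ∀ b, P v b := by
  obtain ⟨φ, hφ⟩ := hP
  refine ⟨φ.all, fun v => ?_⟩
  rw [BoundedFormula.realize_all]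
  refine forall_congr' fun b => ?_
  rw [hφ]
  simp

theorem ex {P : (Fin n → B) → B → Prop}
    (hP : IsDefinable L fun v : Fin (n + 1) → B =>
      P (fun i => v i.castSucc) (v (Fin.last n))) :
    IsDefinable L fun v => ∃ b, P v b := by
  refine (all (P := fun v b => ¬P v b) hP.not).not.of_iff fun v => ?_
  push Not
  rfl

theorem forall_fin {k : ℕ} {P : Fin k → (Fin n → B) → Prop} (hP : ∀ i, IsDefinable L (P i)) :
    IsDefinable L fun v => ∀ i, P i v := by
  induction k with
  | zero => exact true.of_iff fun v => iff_of_true (fun i => i.elim0) trivial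
  | succ k ih =>
    exact ((hP 0).and (ih fun i => hP i.succ)).of_iff fun v => Fin.forall_fin_succ

theorem comap {k : ℕ} (hP : IsDefinable L P) (f : Fin n → Fin k) :
    IsDefinable L fun v : Fin k → B => P fun i => v (f i) := by
  obtain ⟨φ, hφ⟩ := hP
  exact ⟨renameVars φ f, fun v => (realize_renameVars φ f v).trans (hφ _)⟩

end IsDefinable

/-! ### Definability in second-order arithmetic -/

section Arithmetic

/-- The number denoted by an element of `ℕ₂`. -/
def natOf : NatOrSet → ℕ := Sum.elim id fun _ => 0

/-- The set of numbers denoted by an element of `ℕ₂`. -/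
def setOf : NatOrSet → Set ℕ := Sum.elim (fun _ => ∅) id

theorem natOf_surjective : Function.Surjective natOf := fun a => ⟨.inl a, rfl⟩

theorem setOf_surjective : Function.Surjective setOf := fun S => ⟨.inr S, rfl⟩

variable {n : ℕ}

/-- Definability of relations between elements of `ℕ₂`. -/
abbrev ArithDefinable (P : (Fin n → NatOrSet) → Prop) : Prop := IsDefinable arithLanguage P

/-- A numerical function on `ℕ₂` is definable if its graph is. -/
def ArithFun (f : (Fin n → NatOrSet) → ℕ) : Prop :=
  ArithDefinable fun v : Fin (n + 1) → NatOrSet =>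
    natOf (v (Fin.last n)) = f fun i => v i.castSucc

/-- Zero is the value of exactly two kinds of elements: sets, by the default in `natOf`, and the
number `a` with `a + a = a`. -/
theorem arithDefinable_natOf_eq_zero (i : Fin n) :
    ArithDefinable fun v : Fin n → NatOrSet => natOf (v i) = 0 := by
  refine ((IsDefinable.rel (L := arithLanguage) ArithRel.isNumber ![i]).not.or
    (IsDefinable.rel (L := arithLanguage) ArithRel.add ![i, i, i])).of_iff fun v => ?_
  simp only [Structure.RelMap, Matrix.cons_val]
  rcases v i with a | S <;> simp [natOf]

theorem arithDefinable_natOf_eq_natOf (i j : Fin n) :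
    ArithDefinable fun v : Fin n → NatOrSet => natOf (v i) = natOf (v j) := by
  refine ((IsDefinable.eq i j).or ((arithDefinable_natOf_eq_zero i).and
    (arithDefinable_natOf_eq_zero j))).of_iff fun v => ?_
  rcases v i with a | S <;> rcases v j with b | T <;> simp [natOf, eq_comm]
  omega

theorem ArithFun.var (i : Fin n) : ArithFun fun v : Fin n → NatOrSet => natOf (v i) :=
  arithDefinable_natOf_eq_natOf _ _

theorem ArithFun.weaken {f : (Fin n → NatOrSet) → ℕ} (hf : ArithFun f) :
    ArithFun fun v : Fin (n + 1) → NatOrSet => f fun i => v i.castSucc := by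
  refine (IsDefinable.comap hf
    (Fin.snoc (fun i => i.castSucc.castSucc) (Fin.last _) : Fin (n + 1) → Fin (n + 2))).of_iff
    fun v => ?_
  simp

/-- Because `natOf` is total and surjective, quantification over numbers is quantification over the
whole universe; the same holds for sets through `setOf`. -/
theorem IsDefinable.forall_nat {P : (Fin n → NatOrSet) → ℕ → Prop}
    (hP : ArithDefinable fun v : Fin (n + 1) → NatOrSet =>
      P (fun i => v i.castSucc) (natOf (v (Fin.last n)))) :
    ArithDefinable fun v => ∀ a, P v a :=
  (IsDefinable.all (P := fun v b => P v (natOf b)) hP).of_iff fun _ => natOf_surjective.forall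

theorem IsDefinable.exists_nat {P : (Fin n → NatOrSet) → ℕ → Prop}
    (hP : ArithDefinable fun v : Fin (n + 1) → NatOrSet =>
      P (fun i => v i.castSucc) (natOf (v (Fin.last n)))) :
    ArithDefinable fun v => ∃ a, P v a :=
  (IsDefinable.ex (P := fun v b => P v (natOf b)) hP).of_iff fun _ => natOf_surjective.exists

theorem IsDefinable.forall_set {P : (Fin n → NatOrSet) → Set ℕ → Prop}
    (hP : ArithDefinable fun v : Fin (n + 1) → NatOrSet =>
      P (fun i => v i.castSucc) (setOf (v (Fin.last n)))) :
    ArithDefinable fun v => ∀ S, P v S :=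
  (IsDefinable.all (P := fun v b => P v (setOf b)) hP).of_iff fun _ => setOf_surjective.forall

theorem IsDefinable.subst_nat {f : (Fin n → NatOrSet) → ℕ} (hf : ArithFun f)
    {P : (Fin n → NatOrSet) → ℕ → Prop}
    (hP : ArithDefinable fun v : Fin (n + 1) → NatOrSet =>
      P (fun i => v i.castSucc) (natOf (v (Fin.last n)))) :
    ArithDefinable fun v => P v (f v) := by
  refine (IsDefinable.exists_nat (P := fun v a => a = f v ∧ P v a) (hf.and hP)).of_iff fun v => ?_
  simp

/-- The relation symbol holds only of genuine numbers, while `natOf` also gives sets the value `0`.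
So the variables are first replaced by numbers with the same values. -/
theorem arithDefinable_add (i j k : Fin n) :
    ArithDefinable fun v : Fin n → NatOrSet => natOf (v k) = natOf (v i) + natOf (v j) := by
  have h (f : Fin 3 → Fin (n + 3)) :=
    IsDefinable.rel (L := arithLanguage) (B := NatOrSet) ArithRel.add f
  have h' (i j : Fin (n + 3)) := arithDefinable_natOf_eq_natOf i j
  refine (IsDefinable.ex (P := fun v a => ∃ b c, natOf a = natOf (v i) ∧ natOf b = natOf (v j) ∧
    natOf c = natOf (v k) ∧ Structure.RelMap (L := arithLanguage) ArithRel.add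
      ![a, b, c]) (IsDefinable.ex (IsDefinable.ex (.and (h' _ _) (.and (h' _ _) (.and (h' _ _)
      ((h ![(Fin.last n).castSucc.castSucc, (Fin.last _).castSucc, Fin.last _]).of_iff
      fun v => ?_))))))).of_iff fun v => ?_
  · simp [Structure.RelMap]
  · simp only [Structure.RelMap, Matrix.cons_val]
    constructor
    · intro h
      exact ⟨.inl _, .inl _, .inl _, rfl, rfl, rfl, _, _, rfl, rfl, congrArg Sum.inl h⟩
    · rintro ⟨_, _, _, h₁, h₂, h₃, a, b, rfl, rfl, rfl⟩
      rw [← h₁, ← h₂, ← h₃]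
      rfl

theorem arithDefinable_mul (i j k : Fin n) :
    ArithDefinable fun v : Fin n → NatOrSet => natOf (v k) = natOf (v i) * natOf (v j) := by
  have h (f : Fin 3 → Fin (n + 3)) :=
    IsDefinable.rel (L := arithLanguage) (B := NatOrSet) ArithRel.mul f
  have h' (i j : Fin (n + 3)) := arithDefinable_natOf_eq_natOf i j
  refine (IsDefinable.ex (P := fun v a => ∃ b c, natOf a = natOf (v i) ∧ natOf b = natOf (v j) ∧
    natOf c = natOf (v k) ∧ Structure.RelMap (L := arithLanguage) ArithRel.mul
      ![a, b, c]) (IsDefinable.ex (IsDefinable.ex (.and (h' _ _) (.and (h' _ _) (.and (h' _ _)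
      ((h ![(Fin.last n).castSucc.castSucc, (Fin.last _).castSucc, Fin.last _]).of_iff
      fun v => ?_))))))).of_iff fun v => ?_
  · simp [Structure.RelMap]
  · simp only [Structure.RelMap, Matrix.cons_val]
    constructor
    · intro h
      exact ⟨.inl _, .inl _, .inl _, rfl, rfl, rfl, _, _, rfl, rfl, congrArg Sum.inl h⟩
    · rintro ⟨_, _, _, h₁, h₂, h₃, a, b, rfl, rfl, rfl⟩
      rw [← h₁, ← h₂, ← h₃]
      rfl

namespace ArithFun

variable {f g : (Fin n → NatOrSet) → ℕ}

theorem eq (hf : ArithFun f) (hg : ArithFun g) : ArithDefinable fun v => f v = g v :=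
  IsDefinable.subst_nat (P := fun v a => a = g v) hf hg

theorem add (hf : ArithFun f) (hg : ArithFun g) : ArithFun fun v => f v + g v :=
  IsDefinable.subst_nat (P := fun v a => natOf (v (Fin.last n)) = a + g fun i => v i.castSucc)
    hf.weaken (IsDefinable.subst_nat (P := fun v a =>
      natOf (v (Fin.last n).castSucc) = natOf (v (Fin.last _)) + a) hg.weaken.weaken
      (arithDefinable_add _ _ _))

theorem mul (hf : ArithFun f) (hg : ArithFun g) : ArithFun fun v => f v * g v :=
  IsDefinable.subst_nat (P := fun v a => natOf (v (Fin.last n)) = a * g fun i => v i.castSucc)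
    hf.weaken (IsDefinable.subst_nat (P := fun v a =>
      natOf (v (Fin.last n).castSucc) = natOf (v (Fin.last _)) * a) hg.weaken.weaken
      (arithDefinable_mul _ _ _))

theorem zero : ArithFun fun _ : Fin n → NatOrSet => 0 :=
  arithDefinable_natOf_eq_zero _

theorem one : ArithFun fun _ : Fin n → NatOrSet => 1 := by
  refine (((var (Fin.last n)).mul (var (Fin.last n))).eq (var (Fin.last n)) |>.and
    (arithDefinable_natOf_eq_zero (Fin.last n)).not).of_iff fun v => ?_
  generalize natOf (v (Fin.last n)) = a
  constructor
  · rintro rfl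
    simp
  · rintro ⟨h₁, h₂⟩
    exact Nat.eq_of_mul_eq_mul_left (Nat.pos_of_ne_zero h₂) (by rw [h₁, mul_one])

theorem const (k : ℕ) : ArithFun fun _ : Fin n → NatOrSet => k := by
  induction k with
  | zero => exact zero
  | succ k ih => exact ih.add one

theorem lt (hf : ArithFun f) (hg : ArithFun g) : ArithDefinable fun v => f v < g v := by
  refine (IsDefinable.exists_nat (P := fun v a => f v + a + 1 = g v)
    (((hf.weaken.add (var _)).add one).eq hg.weaken)).of_iff fun v => ?_
  constructor
  · intro h
    exact ⟨g v - f v - 1, by omega⟩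
  · rintro ⟨a, h⟩
    omega

/-- `Nat.pair` is a polynomial on each of the two sides of a comparison, so order, sums and products
suffice. -/
theorem pair (hf : ArithFun f) (hg : ArithFun g) : ArithFun fun v => Nat.pair (f v) (g v) := by
  have hf' := hf.weaken
  have hg' := hg.weaken
  have hy := var (Fin.last n)
  refine ((hf'.lt hg').and (hy.eq ((hg'.mul hg').add hf')) |>.or
    ((hf'.lt hg').not.and (hy.eq (((hf'.mul hf').add hf').add hg')))).of_iff fun v => ?_
  beta_reduce
  unfold Nat.pair
  split_ifs with h <;> simp [h]

theorem fst (hf : ArithFun f) : ArithFun fun v => (f v).unpair.1 := by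
  refine (IsDefinable.exists_nat (P := fun v a => Nat.pair (natOf (v (Fin.last n))) a =
    f fun i => v i.castSucc) (((var _).pair (var _)).eq hf.weaken.weaken)).of_iff fun v => ?_
  constructor
  · intro h
    exact ⟨_, by rw [h, Nat.pair_unpair]⟩
  · rintro ⟨a, h⟩
    beta_reduce
    rw [← h, Nat.unpair_pair]

theorem snd (hf : ArithFun f) : ArithFun fun v => (f v).unpair.2 := by
  refine (IsDefinable.exists_nat (P := fun v a => Nat.pair a (natOf (v (Fin.last n))) =
    f fun i => v i.castSucc) (((var _).pair (var _)).eq hf.weaken.weaken)).of_iff fun v => ?_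
  constructor
  · intro h
    exact ⟨_, by rw [h, Nat.pair_unpair]⟩
  · rintro ⟨a, h⟩
    beta_reduce
    rw [← h, Nat.unpair_pair]

theorem mem (hf : ArithFun f) (i : Fin n) : ArithDefinable fun v => f v ∈ setOf (v i) := by
  refine (IsDefinable.ex (P := fun v b => natOf b = f v ∧
    Structure.RelMap (L := arithLanguage) ArithRel.mem ![b, v i])
    (.and hf ((IsDefinable.rel (L := arithLanguage) ArithRel.mem
      ![Fin.last n, i.castSucc]).of_iff fun v => ?_))).of_iff fun v => ?_
  · simp [Structure.RelMap]
  · simp only [Structure.RelMap, Matrix.cons_val]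
    constructor
    · intro h
      refine ⟨.inl _, rfl, _, setOf (v i), rfl, ?_, h⟩
      rcases hv : v i with a | S
      · rw [hv] at h
        exact h.elim
      · rfl
    · rintro ⟨_, h, a, S, rfl, hS, ha⟩
      rw [hS, ← h]
      exact ha

end ArithFun

end Arithmetic

/-! ### Open sets of a Euclidean space, coded by sets of numbers -/

/-- The `j`-th entry of the sequence coded by a number. -/
def entry : ℕ → ℕ → ℕ
  | 0, k => k.unpair.1
  | j + 1, k => entry j k.unpair.2

/-- Only sequences whose length is fixed by the dimension are needed, so iterated pairing replaces a
coding of sequences of variable length. -/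
theorem exists_entry_eq (j : ℕ) (f : ℕ → ℕ) : ∃ k, ∀ i < j, entry i k = f i := by
  induction j generalizing f with
  | zero => exact ⟨0, by simp⟩
  | succ j ih =>
    obtain ⟨k, hk⟩ := ih fun i => f (i + 1)
    refine ⟨Nat.pair (f 0) k, fun i hi => ?_⟩
    rcases i with _ | i
    · simp [entry]
    · simpa [entry] using hk i (by omega)

/-- A numbering of the rational numbers. -/
noncomputable def ratOf (k : ℕ) : ℝ := ((entry 0 k : ℝ) - entry 1 k) / (entry 2 k + 1)

/-- Cross-multiplying and moving the negative terms across leaves an inequality between natural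
numbers, which is arithmetical. -/
theorem ratOf_lt_ratOf {k l : ℕ} : ratOf k < ratOf l ↔
    entry 0 k * (entry 2 l + 1) + entry 1 l * (entry 2 k + 1) <
      entry 0 l * (entry 2 k + 1) + entry 1 k * (entry 2 l + 1) := by
  rw [ratOf, ratOf, div_lt_div_iff₀ (by positivity) (by positivity), ← @Nat.cast_lt ℝ]
  push_cast
  constructor <;> intro h <;> linarith

theorem exists_ratOf_btwn {x y : ℝ} (h : x < y) : ∃ k, x < ratOf k ∧ ratOf k < y := by
  obtain ⟨r, hr⟩ := exists_rat_btwn h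
  -- The numerator is split into its positive and negative parts; the denominator is stored minus
  -- one, since `ratOf` adds one.
  obtain ⟨k, hk⟩ := exists_entry_eq 3 fun i =>
    if i = 0 then r.num.toNat else if i = 1 then (-r.num).toNat else r.den - 1
  have h0 := hk 0 (by norm_num)
  have h1 := hk 1 (by norm_num)
  have h2 := hk 2 (by norm_num)
  norm_num at h0 h1 h2
  have hnum : ((entry 0 k : ℝ) - entry 1 k) = (r.num : ℝ) := by
    rw [h0, h1]
    have : ((r.num.toNat : ℤ) - ((-r.num).toNat : ℤ)) = r.num := by omega
    exact_mod_cast this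
  have hden : ((entry 2 k : ℝ) + 1) = r.den := by
    rw [h2]
    have : (r.den - 1) + 1 = r.den := Nat.sub_add_cancel r.pos
    exact_mod_cast this
  have : ratOf k = r := by
    rw [ratOf, hnum, hden]
    exact_mod_cast Rat.num_div_den r
  exact ⟨k, by rwa [this]⟩

variable {d : ℕ}

/-- The open rational box with a given number. -/
def box (d k : ℕ) : Set (EuclideanSpace ℝ (Fin d)) :=
  {x | ∀ i : Fin d, ratOf (entry (2 * i) k) < x i ∧ x i < ratOf (entry (2 * i + 1) k)}

theorem isOpen_box (k : ℕ) : IsOpen (box d k) := by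
  have : box d k = ⋂ i : Fin d, ({x | ratOf (entry (2 * i) k) < x i} ∩
      {x | x i < ratOf (entry (2 * i + 1) k)}) := by
    ext x
    simp [box]
  rw [this]
  refine isOpen_iInter_of_finite fun i => ?_
  exact (isOpen_lt (by fun_prop) (by fun_prop)).inter (isOpen_lt (by fun_prop) (by fun_prop))

theorem exists_box_subset {U : Set (EuclideanSpace ℝ (Fin d))} (hU : IsOpen U)
    {x : EuclideanSpace ℝ (Fin d)} (hx : x ∈ U) : ∃ k, x ∈ box d k ∧ box d k ⊆ U := by
  -- The topology is also that of the supremum norm, whose balls are boxes, so coordinatewise bounds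
  -- suffice.
  have hV : IsOpen ((WithLp.toLp 2 : (Fin d → ℝ) → EuclideanSpace ℝ (Fin d)) ⁻¹' U) :=
    hU.preimage (by fun_prop)
  obtain ⟨ε, hε, hball⟩ := Metric.isOpen_iff.1 hV x.ofLp hx
  choose a ha using fun i : Fin d => exists_ratOf_btwn (show x i - ε < x i by linarith)
  choose b hb using fun i : Fin d => exists_ratOf_btwn (show x i < x i + ε by linarith)
  obtain ⟨k, hk⟩ := exists_entry_eq (2 * d) fun j =>
    if h : j / 2 < d then if j % 2 = 0 then a ⟨j / 2, h⟩ else b ⟨j / 2, h⟩ else 0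
  have hka (i : Fin d) : entry (2 * i) k = a i := by
    have := hk (2 * i) (by omega)
    simpa using this
  have hkb (i : Fin d) : entry (2 * i + 1) k = b i := by
    have := hk (2 * i + 1) (by omega)
    have h' : (2 * (i : ℕ) + 1) / 2 = i := by omega
    have h'' : (2 * (i : ℕ) + 1) % 2 = 1 := by omega
    simpa [h', h''] using this
  refine ⟨k, fun i => ?_, fun y hy => ?_⟩
  · rw [hka, hkb]
    exact ⟨(ha i).2, (hb i).1⟩
  · have : y.ofLp ∈ Metric.ball x.ofLp ε := by
      rw [Metric.mem_ball, dist_pi_lt_iff hε]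
      intro i
      have hi := hy i
      rw [hka, hkb] at hi
      rw [Real.dist_eq, abs_lt]
      constructor <;> linarith [(ha i).1, (hb i).2, hi.1, hi.2]
    exact hball this

/-- The union of the rational boxes with numbers in a given set. -/
def boxUnion (d : ℕ) (S : Set ℕ) : Opens (EuclideanSpace ℝ (Fin d)) :=
  ⟨⋃ k ∈ S, box d k, isOpen_biUnion fun k _ => isOpen_box k⟩

theorem mem_boxUnion {S : Set ℕ} {x : EuclideanSpace ℝ (Fin d)} :
    x ∈ boxUnion d S ↔ ∃ k ∈ S, x ∈ box d k := by
  rw [← SetLike.mem_coe]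
  simp [boxUnion]

theorem boxUnion_surjective : Function.Surjective (boxUnion d) := by
  intro U
  refine ⟨{k | box d k ⊆ U}, ?_⟩
  ext x
  rw [SetLike.mem_coe, mem_boxUnion]
  constructor
  · rintro ⟨k, hk, hx⟩
    exact hk hx
  · intro hx
    obtain ⟨k, hxk, hk⟩ := exists_box_subset U.isOpen hx
    exact ⟨k, hk, hxk⟩

/-- A set of numbers codes a point if it consists of the pairs of (the number of) a coordinate and
a rational number below this coordinate of the point. -/
def CodesPoint (Z : Set ℕ) (x : EuclideanSpace ℝ (Fin d)) : Prop :=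
  ∀ (i : Fin d) k, Nat.pair i k ∈ Z ↔ ratOf k < x i

/-- The sets of numbers that code a `d`-tuple of Dedekind cuts. -/
def IsCut (d : ℕ) (Z : Set ℕ) : Prop :=
  ∀ i : Fin d, (∃ k, Nat.pair i k ∈ Z) ∧ (∃ k, Nat.pair i k ∉ Z) ∧
    (∀ k l, ratOf k < ratOf l → Nat.pair i l ∈ Z → Nat.pair i k ∈ Z) ∧
    ∀ k, Nat.pair i k ∈ Z → ∃ l, ratOf k < ratOf l ∧ Nat.pair i l ∈ Z

theorem exists_codesPoint (x : EuclideanSpace ℝ (Fin d)) : ∃ Z, CodesPoint Z x :=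
  ⟨{c | ∃ (i : Fin d) (k : ℕ), Nat.pair i k = c ∧ ratOf k < x i}, fun i k => by
    simp only [Set.mem_ofPred_eq, Nat.pair_eq_pair]
    constructor
    · rintro ⟨j, l, ⟨h, rfl⟩, hlt⟩
      rwa [← Fin.ext h]
    · exact fun h => ⟨i, k, ⟨rfl, rfl⟩, h⟩⟩

/-- A coordinate is recovered as the supremum of its lower cut. Downward closure together with the
absence of a maximum makes membership in the cut depend only on the value of `ratOf`, although this
numbering is not injective. -/
theorem exists_codesPoint_iff {Z : Set ℕ} :
    (∃ x : EuclideanSpace ℝ (Fin d), CodesPoint Z x) ↔ IsCut d Z := by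
  constructor
  · rintro ⟨x, hx⟩ i
    simp only [hx i]
    refine ⟨?_, ?_, fun k l h h' => h.trans h', fun k hk => exists_ratOf_btwn hk⟩
    · obtain ⟨k, hk⟩ := exists_ratOf_btwn (sub_one_lt (x i))
      exact ⟨k, hk.2⟩
    · obtain ⟨k, hk⟩ := exists_ratOf_btwn (lt_add_one (x i))
      exact ⟨k, hk.1.not_gt⟩
  · intro h
    refine ⟨WithLp.toLp 2 fun i => sSup (ratOf '' {k | Nat.pair i k ∈ Z}), fun i k => ?_⟩
    obtain ⟨⟨k₀, h₀⟩, ⟨k₁, h₁⟩, h₂, h₃⟩ := h i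
    have hbdd : BddAbove (ratOf '' {k | Nat.pair i k ∈ Z}) := by
      refine ⟨ratOf k₁, ?_⟩
      rintro _ ⟨k, hk, rfl⟩
      by_contra! hlt
      exact h₁ (h₂ _ _ hlt hk)
    constructor
    · intro hk
      obtain ⟨l, hkl, hl⟩ := h₃ k hk
      exact hkl.trans_le (le_csSup hbdd ⟨l, hl, rfl⟩)
    · intro hk
      obtain ⟨_, ⟨l, hl, rfl⟩, hkl⟩ := exists_lt_of_lt_csSup
        (Set.Nonempty.image ratOf ⟨k₀, h₀⟩) hk
      exact h₂ _ _ hkl hl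

/-- The point coded by `Z` belongs to the box with number `k`. -/
def InBox (d : ℕ) (Z : Set ℕ) (k : ℕ) : Prop :=
  ∀ i : Fin d, Nat.pair i (entry (2 * i) k) ∈ Z ∧
    ∃ l, ratOf l < ratOf (entry (2 * i + 1) k) ∧ Nat.pair i l ∉ Z

theorem CodesPoint.inBox_iff {Z : Set ℕ} {x : EuclideanSpace ℝ (Fin d)} (h : CodesPoint Z x)
    (k : ℕ) : InBox d Z k ↔ x ∈ box d k := by
  refine forall_congr' fun i => ?_
  simp only [h i, not_lt]
  refine and_congr_right fun _ => ⟨?_, fun hlt => ?_⟩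
  · rintro ⟨l, h₁, h₂⟩
    exact h₂.trans_lt h₁
  · obtain ⟨l, hl⟩ := exists_ratOf_btwn hlt
    exact ⟨l, hl.2, hl.1.le⟩

/-- Inclusion is tested point by point, with the points replaced by their codes; the right-hand side
speaks only of numbers and sets of numbers. -/
theorem boxUnion_le_iff {S T : Set ℕ} : boxUnion d S ≤ boxUnion d T ↔
    ∀ Z, IsCut d Z → (∃ k, k ∈ S ∧ InBox d Z k) → ∃ k, k ∈ T ∧ InBox d Z k := by
  constructor
  · rintro h Z hZ ⟨k, hk, hZk⟩
    obtain ⟨x, hx⟩ := exists_codesPoint_iff.2 hZ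
    have hxS := mem_boxUnion.2 ⟨k, hk, (hx.inBox_iff k).1 hZk⟩
    obtain ⟨l, hl, hxl⟩ := mem_boxUnion.1 (h hxS)
    exact ⟨l, hl, (hx.inBox_iff l).2 hxl⟩
  · intro h x hx
    obtain ⟨Z, hZ⟩ := exists_codesPoint x
    obtain ⟨k, hk, hxk⟩ := mem_boxUnion.1 hx
    obtain ⟨l, hl, hZl⟩ := h Z (exists_codesPoint_iff.1 ⟨x, hZ⟩) ⟨k, hk, (hZ.inBox_iff k).2 hxk⟩
    exact mem_boxUnion.2 ⟨l, hl, (hZ.inBox_iff l).1 hZl⟩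

section Definability

variable {n : ℕ} {f g : (Fin n → NatOrSet) → ℕ}

theorem ArithFun.entry (hf : ArithFun f) (j : ℕ) : ArithFun fun v => entry j (f v) := by
  induction j generalizing f with
  | zero => exact hf.fst
  | succ j ih => exact ih hf.snd

theorem ArithFun.ratOf_lt (hf : ArithFun f) (hg : ArithFun g) :
    ArithDefinable fun v => ratOf (f v) < ratOf (g v) := by
  refine IsDefinable.of_iff ?_ fun v => ratOf_lt_ratOf
  have hf' := (hf.entry 2).add .one
  have hg' := (hg.entry 2).add .one
  exact (((hf.entry 0).mul hg').add ((hg.entry 1).mul hf')).lt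
    (((hg.entry 0).mul hf').add ((hf.entry 1).mul hg'))

theorem arithDefinable_isCut (j : Fin n) :
    ArithDefinable fun v : Fin n → NatOrSet => IsCut d (setOf (v j)) := by
  refine IsDefinable.forall_fin fun i => ?_
  refine .and ?_ (.and ?_ (.and ?_ ?_))
  · exact .exists_nat (((ArithFun.const _).pair (.var _)).mem _)
  · exact .exists_nat (((ArithFun.const _).pair (.var _)).mem _).not
  · exact .forall_nat (.forall_nat (((ArithFun.var _).ratOf_lt (.var _)).imp
      ((((ArithFun.const _).pair (.var _)).mem _).imp
        (((ArithFun.const _).pair (.var _)).mem _))))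
  · exact .forall_nat ((((ArithFun.const _).pair (.var _)).mem _).imp
      (.exists_nat (((ArithFun.var _).ratOf_lt (.var _)).and
        (((ArithFun.const _).pair (.var _)).mem _))))

theorem ArithFun.inBox (hf : ArithFun f) (j : Fin n) :
    ArithDefinable fun v => InBox d (setOf (v j)) (f v) := by
  refine IsDefinable.forall_fin fun i => .and ?_ ?_
  · exact ((ArithFun.const _).pair (hf.entry _)).mem _
  · exact .exists_nat (((ArithFun.var _).ratOf_lt (hf.weaken.entry _)).and
      (((ArithFun.const _).pair (.var _)).mem _).not)

theorem arithDefinable_boxUnion_le (i j : Fin n) : ArithDefinable fun v : Fin n → NatOrSet =>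
    boxUnion d (setOf (v i)) ≤ boxUnion d (setOf (v j)) := by
  refine IsDefinable.of_iff ?_ fun v => boxUnion_le_iff
  exact .forall_set ((arithDefinable_isCut _).imp (.imp
    (.exists_nat (((ArithFun.var _).mem _).and ((ArithFun.var _).inBox _)))
    (.exists_nat (((ArithFun.var _).mem _).and ((ArithFun.var _).inBox _)))))

end Definability

theorem orderSymbolNumber_injective (l : ℕ) : Function.Injective (orderSymbolNumber l) := by
  intro R S _
  cases R
  cases S
  rfl

/-- The theory of the lattice of open subsets of a Euclidean space is reducible to second-order
arithmetic. -/
theorem FOOpens_manyOneReducible_FOArith (d : ℕ) :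
    (fun k : ℕ => k ∈ FOOpens (EuclideanSpace ℝ (Fin d))) ≤₀ fun k : ℕ => k ∈ FOArith := by
  let _ : FirstOrder.Language.order.Structure (Opens (EuclideanSpace ℝ (Fin d))) :=
    FirstOrder.Language.orderStructure _
  -- No parameters are needed. A number names the empty open set, because its `setOf` is empty.
  let π : NatOrSet → Opens (EuclideanSpace ℝ (Fin d)) := fun b => boxUnion d (setOf b)
  refine FO_manyOneReducible orderSymbolNumber_injective arithSymbolNumber_injective
    [⟨2, .le⟩] ?_ (B := NatOrSet) (m := 0) (Φ := fun _ => True)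
    (E := fun v => π (v 0) = π (v 1))
    (ρ := fun l R v => Structure.RelMap R fun i => π (v (Fin.natAdd 0 i))) ?_ ?_ ?_ ⟨default, trivial⟩
    fun p _ => ⟨π, ?_, ?_, ?_⟩
  · rintro ⟨l, R⟩
    cases R
    simp
  · exact .true
  · exact ((arithDefinable_boxUnion_le (d := d) 0 1).and
      (arithDefinable_boxUnion_le 1 0)).of_iff fun v => le_antisymm_iff
  · intro l R
    cases R
    exact arithDefinable_boxUnion_le (d := d) (Fin.natAdd 0 (0 : Fin 2)) (Fin.natAdd 0 (1 : Fin 2))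
  · exact boxUnion_surjective.comp setOf_surjective
  · intro x y
    have h0 : Fin.append p ![x, y] 0 = x := Fin.append_right p ![x, y] 0
    have h1 : Fin.append p ![x, y] 1 = y := Fin.append_right p ![x, y] 1
    rw [h0, h1]
  · intro l R xs
    simp only [Fin.append_right]
    rfl

/-! ### Second-order arithmetic in a lattice

The coatoms of the lattice of open sets are the complements of points, and the point that belongs
to a coatom `a` is an element of `U` if and only if `¬U ≤ a`. -/

section LatticeDefinitions

variable {O : Type} [CompleteLattice O]

/-- `a` is (the complement of) a point outside `U`. -/
def IsPointOutside (U a : O) : Prop := IsCoatom a ∧ U ≤ a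

/-- The order-theoretic form of preconnectedness of an open set. -/
def IsOrderConnected (V : O) : Prop :=
  ∀ A B : O, (∀ x, IsCoatom x → ¬V ≤ x → ¬A ≤ x ∨ ¬B ≤ x) →
    (∃ x, IsCoatom x ∧ ¬V ≤ x ∧ ¬A ≤ x) → (∃ x, IsCoatom x ∧ ¬V ≤ x ∧ ¬B ≤ x) →
      ∃ x, IsCoatom x ∧ ¬V ≤ x ∧ ¬A ≤ x ∧ ¬B ≤ x

/-- The points `a` and `b` are in the same connected component of `W`. -/
def SameComponent (W a b : O) : Prop := ∃ V, V ≤ W ∧ IsOrderConnected V ∧ ¬V ≤ a ∧ ¬V ≤ b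

/-- The parameters `p` consist of the complement `p 0` of a discrete set, the complement `p 1` of
a set of numbers, open sets `p 2` and `p 3` whose components form a grid, the code `p 4` of the
successor relation, and the number zero `p 5`. -/
def IsPair (p : Fin 6 → O) (a b c : O) : Prop :=
  IsPointOutside (p 0) c ∧ SameComponent (p 2) a c ∧ SameComponent (p 3) b c

/-- The binary relation coded by an open set `V`. -/
def Coded (p : Fin 6 → O) (V a b : O) : Prop := ∃ c, IsPair p a b c ∧ ¬V ≤ c

/-- The property of being a number. -/
abbrev IsNum (p : Fin 6 → O) (a : O) : Prop := IsPointOutside (p 1) a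

/-- All subsets of the discrete set are traces of open sets, and the elements of the discrete set
represent all pairs of numbers. -/
def IsGrid (p : Fin 6 → O) : Prop :=
  p 0 ≤ p 1 ∧
  (∀ c, IsPointOutside (p 0) c → ∃ V, ∀ c', IsPointOutside (p 0) c' → (¬V ≤ c' ↔ c' = c)) ∧
  (∀ a, IsNum p a → ∀ b, IsNum p b → ∃ c, IsPair p a b c ∧
    ∀ a', IsNum p a' → ∀ b', IsNum p b' → IsPair p a' b' c → a' = a ∧ b' = b) ∧
  ∀ U, ∃ U', ¬IsNum p U' ∧ ∀ a, IsNum p a → (U' ≤ a ↔ U ≤ a)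

/-- The Peano axioms. -/
def IsPeano (p : Fin 6 → O) : Prop :=
  IsNum p (p 5) ∧
  (∀ a, IsNum p a → ∃ b, IsNum p b ∧ Coded p (p 4) a b) ∧
  (∀ a, IsNum p a → ∀ b, IsNum p b → ∀ b', IsNum p b' →
    Coded p (p 4) a b → Coded p (p 4) a b' → b = b') ∧
  (∀ a, IsNum p a → ∀ a', IsNum p a' → ∀ b, IsNum p b →
    Coded p (p 4) a b → Coded p (p 4) a' b → a = a') ∧
  (∀ a, IsNum p a → ¬Coded p (p 4) a (p 5)) ∧
  ∀ U, ¬U ≤ p 5 → (∀ a, IsNum p a → ∀ b, IsNum p b →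
    Coded p (p 4) a b → ¬U ≤ a → ¬U ≤ b) → ∀ a, IsNum p a → ¬U ≤ a

/-- The graph of addition. -/
def IsSum (p : Fin 6 → O) (x y w : O) : Prop :=
  ∀ V, Coded p V (p 5) x →
    (∀ a, IsNum p a → ∀ b, IsNum p b → ∀ a', IsNum p a' → ∀ b', IsNum p b' → Coded p V a b →
      Coded p (p 4) a a' → Coded p (p 4) b b' → Coded p V a' b') → Coded p V y w

/-- The graph of multiplication. -/
def IsProd (p : Fin 6 → O) (x y w : O) : Prop :=
  ∀ V, Coded p V (p 5) (p 5) →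
    (∀ a, IsNum p a → ∀ b, IsNum p b → ∀ a', IsNum p a' → ∀ b', IsNum p b' → Coded p V a b →
      Coded p (p 4) a a' → IsSum p b x b' → Coded p V a' b') → Coded p V y w

/-- Equality in the interpretation of second-order arithmetic. -/
def InterpEq (p : Fin 6 → O) (x y : O) : Prop :=
  x = y ∨ ¬IsNum p x ∧ ¬IsNum p y ∧ ∀ a, IsNum p a → (x ≤ a ↔ y ≤ a)

/-- The relations in the interpretation of second-order arithmetic. -/
def InterpRel (p : Fin 6 → O) : ∀ {l}, arithLanguage.Relations l → (Fin l → O) → Prop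
  | _, .isNumber, x => IsNum p (x 0)
  | _, .isSet, x => ¬IsNum p (x 0)
  | _, .mem, x => IsNum p (x 0) ∧ ¬IsNum p (x 1) ∧ ¬x 1 ≤ x 0
  | _, .add, x => IsNum p (x 0) ∧ IsNum p (x 1) ∧ IsNum p (x 2) ∧ IsSum p (x 0) (x 1) (x 2)
  | _, .mul, x => IsNum p (x 0) ∧ IsNum p (x 1) ∧ IsNum p (x 2) ∧ IsProd p (x 0) (x 1) (x 2)

end LatticeDefinitions

/-! ### First-order definability of the lattice notions -/

section LatticeDefinability

variable {O : Type} [CompleteLattice O] [FirstOrder.Language.order.Structure O]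
  [FirstOrder.Language.order.OrderedStructure O] {n : ℕ}

/-- Definability in a partial order. -/
abbrev OrderDefinable (P : (Fin n → O) → Prop) : Prop := IsDefinable FirstOrder.Language.order P

theorem orderDefinable_le (i j : Fin n) : OrderDefinable fun v : Fin n → O => v i ≤ v j := by
  refine (IsDefinable.rel (L := FirstOrder.Language.order) leSymb ![i, j]).of_iff fun v => ?_
  rw [relMap_leSymb]
  rfl

theorem orderDefinable_isCoatom (i : Fin n) :
    OrderDefinable fun v : Fin n → O => IsCoatom (v i) := by
  have h (i j : Fin (n + 1)) := orderDefinable_le (O := O) i j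
  have h' (i j : Fin (n + 2)) := orderDefinable_le (O := O) i j
  -- The signature has no symbol for `⊤`: being different from it means that some element is not
  -- below, and being equal to it means that all elements are.
  refine (IsDefinable.and (.ex (P := fun v U => ¬U ≤ v i) (h _ _).not)
    (.all (P := fun v U => v i ≤ U → U ≤ v i ∨ ∀ V, V ≤ U)
      ((h _ _).imp ((h _ _).or (.all (h' _ _)))))).of_iff fun v => ?_
  simp only [IsCoatom]
  constructor
  · rintro ⟨h₁, h₂⟩
    refine ⟨⟨⊤, fun h => h₁ (top_le_iff.1 h)⟩, fun U hU => ?_⟩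
    rcases hU.lt_or_eq with h | h
    · exact .inr fun V => le_top.trans_eq (h₂ U h).symm
    · exact .inl h.ge
  · rintro ⟨⟨U, hU⟩, h⟩
    refine ⟨fun h' => hU (le_top.trans_eq h'.symm), fun V hV => ?_⟩
    exact top_le_iff.1 (((h V hV.le).resolve_left hV.not_ge) ⊤)

theorem orderDefinable_isPointOutside (i j : Fin n) :
    OrderDefinable fun v : Fin n → O => IsPointOutside (v i) (v j) :=
  (orderDefinable_isCoatom _).and (orderDefinable_le _ _)

theorem orderDefinable_isOrderConnected (i : Fin n) :
    OrderDefinable fun v : Fin n → O => IsOrderConnected (v i) := by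
  have c {n : ℕ} (i : Fin n) := orderDefinable_isCoatom (O := O) i
  have l {n : ℕ} (i j : Fin n) := (orderDefinable_le (O := O) i j).not
  exact .all (.all ((IsDefinable.all ((c _).imp ((l _ _).imp ((l _ _).or (l _ _))))).imp
    ((IsDefinable.ex ((c _).and ((l _ _).and (l _ _)))).imp
      ((IsDefinable.ex ((c _).and ((l _ _).and (l _ _)))).imp
        (IsDefinable.ex ((c _).and ((l _ _).and ((l _ _).and (l _ _)))))))))

theorem orderDefinable_sameComponent (i j k : Fin n) :
    OrderDefinable fun v : Fin n → O => SameComponent (v i) (v j) (v k) :=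
  .ex ((orderDefinable_le _ _).and ((orderDefinable_isOrderConnected _).and
    ((orderDefinable_le _ _).not.and (orderDefinable_le _ _).not)))

variable (e : Fin 6 → Fin n)

theorem orderDefinable_isNum (i : Fin n) :
    OrderDefinable fun v : Fin n → O => IsNum (fun j => v (e j)) (v i) :=
  orderDefinable_isPointOutside _ _

theorem orderDefinable_isPair (i j k : Fin n) :
    OrderDefinable fun v : Fin n → O => IsPair (fun j => v (e j)) (v i) (v j) (v k) :=
  (orderDefinable_isPointOutside _ _).and ((orderDefinable_sameComponent _ _ _).and
    (orderDefinable_sameComponent _ _ _))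

theorem orderDefinable_coded (i j k : Fin n) :
    OrderDefinable fun v : Fin n → O => Coded (fun j => v (e j)) (v i) (v j) (v k) :=
  .ex ((orderDefinable_isPair _ _ _ _).and (orderDefinable_le _ _).not)

variable {e} in
theorem IsDefinable.forall_num {P : (Fin n → O) → O → Prop}
    (hP : OrderDefinable fun v : Fin (n + 1) → O => P (fun i => v i.castSucc) (v (Fin.last n))) :
    OrderDefinable fun v => ∀ a, IsNum (fun j => v (e j)) a → P v a :=
  .all ((orderDefinable_isNum _ _).imp hP)

variable {e} in
theorem IsDefinable.exists_num {P : (Fin n → O) → O → Prop}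
    (hP : OrderDefinable fun v : Fin (n + 1) → O => P (fun i => v i.castSucc) (v (Fin.last n))) :
    OrderDefinable fun v => ∃ a, IsNum (fun j => v (e j)) a ∧ P v a :=
  .ex ((orderDefinable_isNum _ _).and hP)

theorem orderDefinable_isGrid : OrderDefinable fun p : Fin 6 → O => IsGrid p := by
  refine .and (orderDefinable_le _ _) (.and ?_ (.and ?_ ?_))
  · exact .all ((orderDefinable_isPointOutside _ _).imp (.ex (.all
      ((orderDefinable_isPointOutside _ _).imp ((orderDefinable_le _ _).not.iff (.eq _ _))))))
  · refine .forall_num (e := id) (.forall_num (.ex (.and (orderDefinable_isPair _ _ _ _)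
      (.forall_num (.forall_num ((orderDefinable_isPair _ _ _ _).imp
        ((IsDefinable.eq _ _).and (IsDefinable.eq _ _))))))))
  · exact .all (.ex ((orderDefinable_isNum _ _).not.and (.forall_num
      ((orderDefinable_le _ _).iff (orderDefinable_le _ _)))))

theorem orderDefinable_isPeano : OrderDefinable fun p : Fin 6 → O => IsPeano p := by
  have c {n : ℕ} (e : Fin 6 → Fin n) (i j k : Fin n) := orderDefinable_coded (O := O) e i j k
  refine .and (orderDefinable_isNum id _) (.and ?_ (.and ?_ (.and ?_ (.and ?_ ?_))))
  · exact .forall_num (e := id) (.exists_num (c _ _ _ _))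
  · exact .forall_num (e := id) (.forall_num (.forall_num ((c _ _ _ _).imp ((c _ _ _ _).imp
      (.eq _ _)))))
  · exact .forall_num (e := id) (.forall_num (.forall_num ((c _ _ _ _).imp ((c _ _ _ _).imp
      (.eq _ _)))))
  · exact .forall_num (e := id) (c _ _ _ _).not
  · exact .all ((orderDefinable_le _ _).not.imp ((IsDefinable.forall_num (.forall_num
      ((c _ _ _ _).imp ((orderDefinable_le _ _).not.imp (orderDefinable_le _ _).not)))).imp
      (.forall_num (orderDefinable_le _ _).not)))

theorem orderDefinable_isSum (i j k : Fin n) :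
    OrderDefinable fun v : Fin n → O => IsSum (fun j => v (e j)) (v i) (v j) (v k) := by
  have c {n : ℕ} (e : Fin 6 → Fin n) (i j k : Fin n) := orderDefinable_coded (O := O) e i j k
  exact .all ((c _ _ _ _).imp ((IsDefinable.forall_num (.forall_num (.forall_num (.forall_num
    ((c _ _ _ _).imp ((c _ _ _ _).imp ((c _ _ _ _).imp (c _ _ _ _)))))))).imp (c _ _ _ _)))

theorem orderDefinable_isProd (i j k : Fin n) :
    OrderDefinable fun v : Fin n → O => IsProd (fun j => v (e j)) (v i) (v j) (v k) := by
  have c {n : ℕ} (e : Fin 6 → Fin n) (i j k : Fin n) := orderDefinable_coded (O := O) e i j k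
  exact .all ((c _ _ _ _).imp ((IsDefinable.forall_num (.forall_num (.forall_num (.forall_num
    ((c _ _ _ _).imp ((c _ _ _ _).imp ((orderDefinable_isSum _ _ _ _).imp (c _ _ _ _)))))))).imp
      (c _ _ _ _)))

theorem orderDefinable_interpEq (i j : Fin n) :
    OrderDefinable fun v : Fin n → O => InterpEq (fun j => v (e j)) (v i) (v j) :=
  (IsDefinable.eq _ _).or ((orderDefinable_isNum _ _).not.and ((orderDefinable_isNum _ _).not.and
    (.forall_num ((orderDefinable_le _ _).iff (orderDefinable_le _ _)))))

theorem orderDefinable_interpRel {l : ℕ} (R : arithLanguage.Relations l) (f : Fin l → Fin n) :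
    OrderDefinable fun v : Fin n → O => InterpRel (fun j => v (e j)) R fun i => v (f i) := by
  have h (i : Fin n) := orderDefinable_isNum (O := O) e i
  cases R with
  | isNumber => exact h _
  | isSet => exact (h _).not
  | mem => exact (h _).and ((h _).not.and (orderDefinable_le _ _).not)
  | add => exact (h _).and ((h _).and ((h _).and (orderDefinable_isSum _ _ _ _)))
  | mul => exact (h _).and ((h _).and ((h _).and (orderDefinable_isProd _ _ _ _)))

end LatticeDefinability

/-! ### Second-order arithmetic inside a complete lattice with a grid -/

section LatticeInterpretation

variable {O : Type} [CompleteLattice O] {p : Fin 6 → O}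

/-- Every set of points of the discrete set is the trace of an open set. -/
theorem IsGrid.exists_trace (h : IsGrid p) (Q : O → Prop) :
    ∃ V, ∀ c, IsPointOutside (p 0) c → (¬V ≤ c ↔ Q c) := by
  obtain ⟨-, hd, -, -⟩ := h
  choose V hV using hd
  -- The join of the elements that isolate the points satisfying `Q`; it fails to be below `c` iff
  -- one of the joined elements does, which forces that point to be `c`.
  refine ⟨⨆ (c) (hc : IsPointOutside (p 0) c) (_ : Q c), V c hc, fun c hc => ?_⟩
  simp only [iSup_le_iff]
  push Not
  constructor
  · rintro ⟨c', hc', hQ, hV'⟩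
    rwa [(hV c' hc' c hc).1 hV']
  · exact fun hQ => ⟨c, hc, hQ, (hV c hc c hc).2 rfl⟩

theorem IsGrid.isPointOutside (h : IsGrid p) {a : O} (ha : IsNum p a) : IsPointOutside (p 0) a :=
  ⟨ha.1, h.1.trans ha.2⟩

/-- Every set of numbers is the trace of an open set that does not itself represent a number. -/
theorem IsGrid.exists_trace_not_isNum (h : IsGrid p) (Q : O → Prop) :
    ∃ U, ¬IsNum p U ∧ ∀ a, IsNum p a → (¬U ≤ a ↔ Q a) := by
  obtain ⟨V, hV⟩ := h.exists_trace Q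
  obtain ⟨U, hU, hUV⟩ := h.2.2.2 V
  exact ⟨U, hU, fun a ha => by rw [hUV a ha, hV a (h.isPointOutside ha)]⟩

/-- Every binary relation between numbers is coded by an open set. -/
theorem IsGrid.exists_code (h : IsGrid p) (R : O → O → Prop) :
    ∃ V, ∀ a b, IsNum p a → IsNum p b → (Coded p V a b ↔ R a b) := by
  -- Only points that represent a single pair are selected, so a point selected for one pair cannot
  -- put another pair into the coded relation.
  obtain ⟨V, hV⟩ := h.exists_trace fun c => ∃ a b, IsNum p a ∧ IsNum p b ∧ R a b ∧ IsPair p a b c ∧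
    ∀ a', IsNum p a' → ∀ b', IsNum p b' → IsPair p a' b' c → a' = a ∧ b' = b
  refine ⟨V, fun a b ha hb => ⟨?_, fun hR => ?_⟩⟩
  · rintro ⟨c, hc, hVc⟩
    obtain ⟨a', b', -, -, hR, -, huniq⟩ := (hV c hc.1).1 hVc
    obtain ⟨rfl, rfl⟩ := huniq a ha b hb hc
    exact hR
  · obtain ⟨c, hc, huniq⟩ := h.2.2.1 a ha b hb
    exact ⟨c, hc, (hV c hc.1).2 ⟨a, b, ha, hb, hR, hc, huniq⟩⟩

/-- The numbers are isomorphic to the natural numbers. -/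
theorem exists_numbering (hg : IsGrid p) (hp : IsPeano p) : ∃ ν : ℕ → O,
    (∀ k, IsNum p (ν k)) ∧ Function.Injective ν ∧ (∀ a, IsNum p a → ∃ k, ν k = a) ∧ ν 0 = p 5 ∧
    ∀ k l, Coded p (p 4) (ν k) (ν l) ↔ l = k + 1 := by
  obtain ⟨hz, hex, huniq, hinj, hns, hind⟩ := hp
  choose! σ hσ hcode using hex
  let ν : ℕ → O := fun k => σ^[k] (p 5)
  have hsucc (k : ℕ) : ν (k + 1) = σ (ν k) := Function.iterate_succ_apply' σ k (p 5)
  have hν (k : ℕ) : IsNum p (ν k) := by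
    induction k with
    | zero => exact hz
    | succ k ih =>
      rw [hsucc]
      exact hσ _ ih
  have hνs (k : ℕ) : Coded p (p 4) (ν k) (ν (k + 1)) := by
    rw [hsucc]
    exact hcode _ (hν k)
  have hνinj : Function.Injective ν := by
    intro k
    induction k with
    | zero =>
      rintro (_ | l) h
      · rfl
      · exact absurd (h ▸ hνs l : Coded p (p 4) (ν l) (ν 0)) (hns _ (hν l))
    | succ k ih =>
      rintro (_ | l) h
      · exact absurd (h ▸ hνs k : Coded p (p 4) (ν k) (ν 0)) (hns _ (hν k))
      · have hl := hνs l
        rw [← h] at hl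
        rw [ih (hinj _ (hν k) _ (hν l) _ (hν _) (hνs k) hl)]
  refine ⟨ν, hν, hνinj, ?_, rfl, fun k l => ⟨fun h => ?_, ?_⟩⟩
  -- The range of `ν` is itself the trace of an element of the lattice, so the induction axiom
  -- applies to it and excludes nonstandard numbers.
  · obtain ⟨U, -, hU⟩ := hg.exists_trace_not_isNum fun a => ∃ k, ν k = a
    intro a ha
    refine (hU a ha).1 (hind U ((hU _ hz).2 ⟨0, rfl⟩) ?_ a ha)
    intro a ha b hb hab hUa
    obtain ⟨k, rfl⟩ := (hU a ha).1 hUa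
    exact (hU b hb).2 ⟨k + 1, huniq _ ha _ (hν _) _ hb (hνs k) hab⟩
  · exact hνinj (huniq _ (hν k) _ (hν l) _ (hν _) h (hνs k))
  · rintro rfl
    exact hνs k

section Numbering

variable {ν : ℕ → O} (hg : IsGrid p) (hν : ∀ k, IsNum p (ν k)) (hinj : Function.Injective ν)
  (hsurj : ∀ a, IsNum p a → ∃ k, ν k = a) (hzero : ν 0 = p 5)
  (hsucc : ∀ k l, Coded p (p 4) (ν k) (ν l) ↔ l = k + 1)

include hg hν hinj

theorem exists_code_numbering (R : ℕ → ℕ → Prop) :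
    ∃ V, ∀ k l, Coded p V (ν k) (ν l) ↔ R k l := by
  obtain ⟨V, hV⟩ := hg.exists_code fun a b => ∃ k l, ν k = a ∧ ν l = b ∧ R k l
  refine ⟨V, fun k l => (hV _ _ (hν k) (hν l)).trans ⟨?_, fun h => ⟨k, l, rfl, rfl, h⟩⟩⟩
  rintro ⟨k', l', hk, hl, h⟩
  rwa [← hinj hk, ← hinj hl]

include hsurj hzero hsucc

/-- `IsSum` intersects all coded relations that contain `(0, x)` and are closed under taking
successors in both places. The graph of `k ↦ x + k` is the least such relation and is itself coded.
Multiplication is treated alike, with the step `(k, l) ↦ (k + 1, l + x)`. -/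
theorem isSum_iff (x y w : ℕ) : IsSum p (ν x) (ν y) (ν w) ↔ w = x + y := by
  constructor
  · intro h
    obtain ⟨V, hV⟩ := exists_code_numbering hg hν hinj fun k l => l = x + k
    refine (hV y w).1 (h V ?_ ?_)
    · rw [← hzero]
      exact (hV 0 x).2 rfl
    · intro a ha b hb a' ha' b' hb' hab haa' hbb'
      obtain ⟨k, rfl⟩ := hsurj a ha
      obtain ⟨l, rfl⟩ := hsurj b hb
      obtain ⟨k', rfl⟩ := hsurj a' ha'
      obtain ⟨l', rfl⟩ := hsurj b' hb'
      rw [hV] at hab ⊢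
      rw [hsucc] at haa' hbb'
      omega
  · rintro rfl V h0 hstep
    induction y with
    | zero => rwa [hzero]
    | succ y ih =>
      exact hstep _ (hν _) _ (hν _) _ (hν _) _ (hν _) ih ((hsucc _ _).2 rfl) ((hsucc _ _).2 rfl)

theorem isProd_iff (x y w : ℕ) : IsProd p (ν x) (ν y) (ν w) ↔ w = x * y := by
  constructor
  · intro h
    obtain ⟨V, hV⟩ := exists_code_numbering hg hν hinj fun k l => l = x * k
    refine (hV y w).1 (h V ?_ ?_)
    · rw [← hzero]
      exact (hV 0 0).2 rfl
    · intro a ha b hb a' ha' b' hb' hab haa' hbb'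
      obtain ⟨k, rfl⟩ := hsurj a ha
      obtain ⟨l, rfl⟩ := hsurj b hb
      obtain ⟨k', rfl⟩ := hsurj a' ha'
      obtain ⟨l', rfl⟩ := hsurj b' hb'
      rw [hV] at hab ⊢
      rw [hsucc] at haa'
      rw [isSum_iff hg hν hinj hsurj hzero hsucc] at hbb'
      rw [hbb', hab, haa']
      ring
  · rintro rfl V h0 hstep
    induction y with
    | zero => rwa [mul_zero, hzero]
    | succ y ih =>
      exact hstep _ (hν _) _ (hν _) _ (hν _) _ (hν _) ih ((hsucc _ _).2 rfl)
        ((isSum_iff hg hν hinj hsurj hzero hsucc _ _ _).2 rfl)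

end Numbering

/-- A grid with a Peano structure yields a copy of second-order arithmetic. -/
theorem exists_interpretation (hg : IsGrid p) (hp : IsPeano p) : ∃ π : O → NatOrSet,
    Function.Surjective π ∧ (∀ x y, InterpEq p x y ↔ π x = π y) ∧
    ∀ l (R : arithLanguage.Relations l) xs,
      InterpRel p R xs ↔ Structure.RelMap R (π ∘ xs) := by
  classical
  obtain ⟨ν, hν, hinj, hsurj, hzero, hsucc⟩ := exists_numbering hg hp
  -- A representative of a number denotes that number; every other element denotes the set of
  -- numbers in its trace. Surjectivity therefore needs traces of elements that are not themselves
  -- numbers.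
  let π : O → NatOrSet := fun x =>
    if h : IsNum p x then .inl (hsurj x h).choose else .inr {k | ¬x ≤ ν k}
  have hπν (k : ℕ) : π (ν k) = .inl k := by
    simp only [π, hν k, dif_pos]
    exact congrArg _ (hinj (hsurj _ (hν k)).choose_spec)
  have hπset {x : O} (h : ¬IsNum p x) : π x = .inr {k | ¬x ≤ ν k} := by
    simp only [π, h, dif_neg, not_false_eq_true]
  have hπnum {x : O} {k : ℕ} : π x = .inl k ↔ x = ν k := by
    constructor
    · intro h
      by_cases hx : IsNum p x
      · obtain ⟨l, rfl⟩ := hsurj x hx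
        rw [hπν] at h
        rw [Sum.inl_injective h]
      · simp [hπset hx] at h
    · rintro rfl
      exact hπν k
  have hπinl {x : O} : (∃ k, π x = .inl k) ↔ IsNum p x := by
    simp only [hπnum]
    constructor
    · rintro ⟨k, rfl⟩
      exact hν k
    · intro h
      obtain ⟨k, hk⟩ := hsurj x h
      exact ⟨k, hk.symm⟩
  refine ⟨π, ?_, fun x y => ?_, fun l R xs => ?_⟩
  · rintro (k | S)
    · exact ⟨ν k, hπν k⟩
    · obtain ⟨U, hU, hUS⟩ := hg.exists_trace_not_isNum fun a => ∃ k ∈ S, ν k = a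
      refine ⟨U, (hπset hU).trans (congrArg _ ?_)⟩
      ext k
      refine (hUS _ (hν k)).trans ⟨?_, fun h => ⟨k, h, rfl⟩⟩
      rintro ⟨l, hl, h⟩
      rwa [← hinj h]
  · constructor
    · rintro (rfl | ⟨hx, hy, h⟩)
      · rfl
      · rw [hπset hx, hπset hy]
        refine congrArg _ (Set.ext fun k => not_congr (h _ (hν k)))
    · intro h
      by_cases hx : IsNum p x
      · obtain ⟨k, rfl⟩ := hsurj x hx
        rw [hπν] at h
        exact .inl (hπnum.1 h.symm).symm
      · have hy : ¬IsNum p y := by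
          rwa [← hπinl, ← h, hπinl]
        refine .inr ⟨hx, hy, fun a ha => ?_⟩
        obtain ⟨k, rfl⟩ := hsurj a ha
        rw [hπset hx, hπset hy] at h
        exact not_iff_not.1 (Set.ext_iff.1 (Sum.inr_injective h) k)
  · cases R with
    | isNumber => exact hπinl.symm
    | isSet =>
      refine (not_congr hπinl.symm).trans ?_
      change (¬∃ k, π (xs 0) = .inl k) ↔ ∃ S, π (xs 0) = .inr S
      rcases π (xs 0) with k | S <;> simp
    | mem =>
      change (IsNum p (xs 0) ∧ ¬IsNum p (xs 1) ∧ ¬xs 1 ≤ xs 0) ↔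
        ∃ (a : ℕ) (S : Set ℕ), π (xs 0) = .inl a ∧ π (xs 1) = .inr S ∧ a ∈ S
      constructor
      · rintro ⟨h₀, h₁, h⟩
        obtain ⟨k, hk⟩ := hsurj _ h₀
        refine ⟨k, _, hπnum.2 hk.symm, hπset h₁, ?_⟩
        rw [← hk] at h
        exact h
      · rintro ⟨k, S, h₀, h₁, h⟩
        have h₁' : ¬IsNum p (xs 1) := by simp [← hπinl, h₁]
        rw [hπset h₁'] at h₁
        obtain rfl := Sum.inr_injective h₁
        rw [hπnum] at h₀
        rw [h₀]
        exact ⟨hν k, h₁', h⟩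
    | add =>
      change (IsNum p (xs 0) ∧ IsNum p (xs 1) ∧ IsNum p (xs 2) ∧ IsSum p (xs 0) (xs 1) (xs 2)) ↔
        ∃ a b : ℕ, π (xs 0) = .inl a ∧ π (xs 1) = .inl b ∧ π (xs 2) = .inl (a + b)
      simp only [hπnum]
      constructor
      · rintro ⟨h₀, h₁, h₂, h⟩
        obtain ⟨a, ha⟩ := hsurj _ h₀
        obtain ⟨b, hb⟩ := hsurj _ h₁
        obtain ⟨c, hc⟩ := hsurj _ h₂
        rw [← ha, ← hb, ← hc, isSum_iff hg hν hinj hsurj hzero hsucc] at h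
        exact ⟨a, b, ha.symm, hb.symm, by rw [← h, hc]⟩
      · rintro ⟨a, b, h₀, h₁, h₂⟩
        rw [h₀, h₁, h₂]
        exact ⟨hν _, hν _, hν _, (isSum_iff hg hν hinj hsurj hzero hsucc _ _ _).2 rfl⟩
    | mul =>
      change (IsNum p (xs 0) ∧ IsNum p (xs 1) ∧ IsNum p (xs 2) ∧ IsProd p (xs 0) (xs 1) (xs 2)) ↔
        ∃ a b : ℕ, π (xs 0) = .inl a ∧ π (xs 1) = .inl b ∧ π (xs 2) = .inl (a * b)
      simp only [hπnum]
      constructor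
      · rintro ⟨h₀, h₁, h₂, h⟩
        obtain ⟨a, ha⟩ := hsurj _ h₀
        obtain ⟨b, hb⟩ := hsurj _ h₁
        obtain ⟨c, hc⟩ := hsurj _ h₂
        rw [← ha, ← hb, ← hc, isProd_iff hg hν hinj hsurj hzero hsucc] at h
        exact ⟨a, b, ha.symm, hb.symm, by rw [← h, hc]⟩
      · rintro ⟨a, b, h₀, h₁, h₂⟩
        rw [h₀, h₁, h₂]
        exact ⟨hν _, hν _, hν _, (isProd_iff hg hν hinj hsurj hzero hsucc _ _ _).2 rfl⟩

/-- Second-order arithmetic is reducible to the theory of a complete lattice with a grid. -/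
theorem FOArith_manyOneReducible [FirstOrder.Language.order.Structure O]
    [FirstOrder.Language.order.OrderedStructure O] (h : ∃ p : Fin 6 → O, IsGrid p ∧ IsPeano p) :
    (fun k : ℕ => k ∈ FOArith) ≤₀
      fun k : ℕ => k ∈ FO FirstOrder.Language.order orderSymbolNumber O := by
  refine FO_manyOneReducible arithSymbolNumber_injective orderSymbolNumber_injective
    [⟨1, .isNumber⟩, ⟨1, .isSet⟩, ⟨2, .mem⟩, ⟨3, .add⟩, ⟨3, .mul⟩] ?_ (B := O) (m := 6)
    (Φ := fun p => IsGrid p ∧ IsPeano p)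
    (E := fun v => InterpEq (fun i => v (Fin.castAdd 2 i)) (v (Fin.natAdd 6 0)) (v (Fin.natAdd 6 1)))
    (ρ := fun l R v =>
      InterpRel (fun i => v (Fin.castAdd l i)) R fun i => v (Fin.natAdd 6 i)) ?_ ?_ ?_ h
    fun p hp => ?_
  · rintro ⟨l, R⟩
    cases R <;> simp
  · exact orderDefinable_isGrid.and orderDefinable_isPeano
  · exact orderDefinable_interpEq _ _ _
  · exact fun l R => orderDefinable_interpRel _ R _
  · simp only [Fin.append_left, Fin.append_right]
    exact exists_interpretation hp.1 hp.2

end LatticeInterpretation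

/-! ### The lattice of open sets of a Euclidean space -/

section Points

variable {X : Type} [TopologicalSpace X] [T1Space X]

/-- The complement of a point. -/
def pointCompl (x : X) : Opens X := ({x} : Closeds X).compl

theorem mem_pointCompl {x y : X} : y ∈ pointCompl x ↔ y ≠ x := by
  rw [← SetLike.mem_coe]
  simp [pointCompl]

theorem le_pointCompl {U : Opens X} {x : X} : U ≤ pointCompl x ↔ x ∉ U := by
  constructor
  · exact fun h hx => mem_pointCompl.1 (h hx) rfl
  · exact fun hx y hy => mem_pointCompl.2 fun h => hx (h ▸ hy)

theorem not_le_pointCompl {U : Opens X} {x : X} : ¬U ≤ pointCompl x ↔ x ∈ U := by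
  rw [le_pointCompl, not_not]

theorem pointCompl_injective : Function.Injective (pointCompl : X → Opens X) := by
  intro x y h
  by_contra hne
  exact mem_pointCompl.1 (h ▸ mem_pointCompl.2 hne : x ∈ pointCompl x) rfl

theorem isCoatom_iff_exists_pointCompl {U : Opens X} : IsCoatom U ↔ ∃ x, U = pointCompl x :=
  Opens.isCoatom_iff

theorem isPointOutside_pointCompl {U : Opens X} {x : X} :
    IsPointOutside U (pointCompl x) ↔ x ∉ U :=
  (and_iff_right (isCoatom_iff_exists_pointCompl.2 ⟨x, rfl⟩)).trans le_pointCompl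

theorem exists_isCoatom_and {Q : Opens X → Prop} :
    (∃ P, IsCoatom P ∧ Q P) ↔ ∃ x, Q (pointCompl x) := by
  simp [isCoatom_iff_exists_pointCompl]

theorem forall_isCoatom_imp {Q : Opens X → Prop} :
    (∀ P, IsCoatom P → Q P) ↔ ∀ x, Q (pointCompl x) := by
  simp [isCoatom_iff_exists_pointCompl]

/-- Once coatoms are read as points, this is the definition of preconnectedness by pairs of open
sets. -/
theorem isOrderConnected_iff {V : Opens X} : IsOrderConnected V ↔ IsPreconnected (V : Set X) := by
  simp only [IsOrderConnected, exists_isCoatom_and, forall_isCoatom_imp, not_le_pointCompl]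
  constructor
  · exact fun h u v hu hv huv hVu hVv => h ⟨u, hu⟩ ⟨v, hv⟩ (fun z hz => huv hz) hVu hVv
  · exact fun h A B hAB hA hB => h A B A.isOpen B.isOpen (fun z hz => hAB z hz) hA hB

theorem sameComponent_pointCompl {W : Opens X} {x y : X} :
    SameComponent W (pointCompl x) (pointCompl y) ↔
      ∃ V : Opens X, V ≤ W ∧ IsPreconnected (V : Set X) ∧ x ∈ V ∧ y ∈ V := by
  simp only [SameComponent, isOrderConnected_iff, not_le_pointCompl]

end Points

/-! ### The concrete grid in a Euclidean space -/

section Grid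

variable {d : ℕ}

/-- The union of the strips around the hyperplanes on which the coordinate `t` is a natural
number. -/
def strips (t : Fin d) : Opens (EuclideanSpace ℝ (Fin d)) :=
  ⟨⋃ k : ℕ, {x | |x t - k| < 1 / 2}, isOpen_iUnion fun k => isOpen_lt (by fun_prop) (by fun_prop)⟩

theorem mem_strips {t : Fin d} {x : EuclideanSpace ℝ (Fin d)} :
    x ∈ strips t ↔ ∃ k : ℕ, |x t - k| < 1 / 2 := by
  rw [← SetLike.mem_coe]
  simp [strips]

/-- The coordinate `t` maps a connected set onto an interval, while on `strips t` it never takes the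
value `k + 1/2`, the gap between two adjacent strips. -/
theorem not_lt_of_isPreconnected {t : Fin d} {V : Opens (EuclideanSpace ℝ (Fin d))}
    (hV : V ≤ strips t) (hconn : IsPreconnected (V : Set (EuclideanSpace ℝ (Fin d))))
    {x y : EuclideanSpace ℝ (Fin d)} (hx : x ∈ V) (hy : y ∈ V) {k l : ℕ} (hk : x t = k)
    (hl : y t = l) : ¬k < l := by
  intro hkl
  have himage := (hconn.image (fun x => x t) (by fun_prop)).ordConnected
  have hkl' : (k : ℝ) + 1 ≤ l := by exact_mod_cast hkl
  obtain ⟨z, hz, hzt⟩ := himage.out ⟨x, hx, hk⟩ ⟨y, hy, hl⟩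
    (⟨by linarith, by linarith⟩ : (k : ℝ) + 1 / 2 ∈ Set.Icc (k : ℝ) l)
  obtain ⟨m, hm⟩ := mem_strips.1 (hV hz)
  simp only at hzt
  rw [hzt, abs_lt] at hm
  have h₁ : k < m := by
    have : (k : ℝ) < m := by linarith [hm.2]
    exact_mod_cast this
  have h₂ : m < k + 1 := by
    have : (m : ℝ) < k + 1 := by linarith [hm.1]
    exact_mod_cast this
  omega

theorem sameComponent_strips {t : Fin d} {x y : EuclideanSpace ℝ (Fin d)} {k l : ℕ}
    (hk : x t = k) (hl : y t = l) :
    SameComponent (strips t) (pointCompl x) (pointCompl y) ↔ k = l := by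
  rw [sameComponent_pointCompl]
  constructor
  · rintro ⟨V, hV, hconn, hx, hy⟩
    have h₁ := not_lt_of_isPreconnected hV hconn hx hy hk hl
    have h₂ := not_lt_of_isPreconnected hV hconn hy hx hl hk
    omega
  · rintro rfl
    refine ⟨⟨{x | |x t - k| < 1 / 2}, isOpen_lt (by fun_prop) (by fun_prop)⟩,
      fun z hz => mem_strips.2 ⟨k, hz⟩, ?_, ?_, ?_⟩
    -- A single strip is connected because it is convex, being the preimage of an interval under a
    -- linear map.
    · have := (convex_ball (k : ℝ) (1 / 2)).linear_preimage
        (EuclideanSpace.proj t : EuclideanSpace ℝ (Fin d) →L[ℝ] ℝ).toLinearMap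
      exact Convex.isPreconnected this
    · change |x t - k| < 1 / 2
      rw [hk]
      norm_num
    · change |y t - k| < 1 / 2
      rw [hl]
      norm_num

variable (r t : Fin d)

/-- The point with coordinates `i` and `j` at `r` and `t`, and `0` otherwise. -/
noncomputable def gridPoint (i j : ℕ) : EuclideanSpace ℝ (Fin d) :=
  WithLp.toLp 2 fun u => if u = r then (i : ℝ) else if u = t then (j : ℝ) else 0

theorem gridPoint_left (i j : ℕ) : gridPoint r t i j r = i := by simp [gridPoint]

variable {r t} in
theorem gridPoint_right (hrt : r ≠ t) (i j : ℕ) : gridPoint r t i j t = j := by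
  simp [gridPoint, hrt.symm]

/-- The complement of the grid. -/
def gridCompl : Opens (EuclideanSpace ℝ (Fin d)) :=
  ⟨{x | (∃ k : ℕ, (k : ℝ) = x r) ∧ (∃ k : ℕ, (k : ℝ) = x t) ∧ ∀ u, u ≠ r → u ≠ t → x u = 0}ᶜ, by
    have h := Nat.isClosedEmbedding_coe_real.isClosed_range
    rw [isOpen_compl_iff]
    refine (h.preimage (f := fun x : EuclideanSpace ℝ (Fin d) => x r) (by fun_prop)).inter
      ((h.preimage (f := fun x : EuclideanSpace ℝ (Fin d) => x t) (by fun_prop)).inter ?_)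
    have : {x : EuclideanSpace ℝ (Fin d) | ∀ u, u ≠ r → u ≠ t → x u = 0} =
        ⋂ (u) (_ : u ≠ r) (_ : u ≠ t), {x | x u = 0} := by
      ext x
      simp
    change IsClosed {x : EuclideanSpace ℝ (Fin d) | ∀ u, u ≠ r → u ≠ t → x u = 0}
    rw [this]
    exact isClosed_iInter fun u => isClosed_iInter fun _ => isClosed_iInter fun _ =>
      isClosed_eq (by fun_prop) (by fun_prop)⟩

/-- The complement of the diagonal of the grid. -/
def diagonalCompl : Opens (EuclideanSpace ℝ (Fin d)) :=
  gridCompl r t ⊔ ⟨{x | x r ≠ x t}, isOpen_ne_fun (by fun_prop) (by fun_prop)⟩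

variable {r t}

theorem notMem_gridCompl (hrt : r ≠ t) {x : EuclideanSpace ℝ (Fin d)} :
    x ∉ gridCompl r t ↔ ∃ i j, gridPoint r t i j = x := by
  have : x ∉ gridCompl r t ↔
      ((∃ k : ℕ, (k : ℝ) = x r) ∧ (∃ k : ℕ, (k : ℝ) = x t) ∧ ∀ u, u ≠ r → u ≠ t → x u = 0) :=
    not_not
  rw [this]
  constructor
  · rintro ⟨⟨i, hi⟩, ⟨j, hj⟩, h⟩
    refine ⟨i, j, ?_⟩
    ext u
    by_cases hr : u = r
    · rw [hr, gridPoint_left, hi]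
    by_cases ht : u = t
    · rw [ht, gridPoint_right hrt, hj]
    simp [gridPoint, hr, ht, h u hr ht]
  · rintro ⟨i, j, rfl⟩
    exact ⟨⟨i, (gridPoint_left r t i j).symm⟩, ⟨j, (gridPoint_right hrt i j).symm⟩,
      fun u hr ht => by simp [gridPoint, hr, ht]⟩

theorem notMem_diagonalCompl (hrt : r ≠ t) {x : EuclideanSpace ℝ (Fin d)} :
    x ∉ diagonalCompl r t ↔ ∃ i, gridPoint r t i i = x := by
  have : x ∉ diagonalCompl r t ↔ x ∉ gridCompl r t ∧ x r = x t := by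
    rw [diagonalCompl, ← SetLike.mem_coe, Opens.coe_sup, Set.mem_union, not_or]
    exact and_congr_right fun _ => not_not
  rw [this, notMem_gridCompl hrt]
  constructor
  · rintro ⟨⟨i, j, rfl⟩, h⟩
    rw [gridPoint_left, gridPoint_right hrt] at h
    rw [Nat.cast_inj] at h
    exact ⟨i, by rw [h]⟩
  · rintro ⟨i, rfl⟩
    exact ⟨⟨i, i, rfl⟩, by rw [gridPoint_left, gridPoint_right hrt]⟩

theorem gridPoint_inj (hrt : r ≠ t) {i j i' j' : ℕ} :
    gridPoint r t i j = gridPoint r t i' j' ↔ i = i' ∧ j = j' := by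
  constructor
  · intro h
    have hr := congrArg (fun x : EuclideanSpace ℝ (Fin d) => x r) h
    have ht := congrArg (fun x : EuclideanSpace ℝ (Fin d) => x t) h
    simp only [gridPoint_left, gridPoint_right hrt, Nat.cast_inj] at hr ht
    exact ⟨hr, ht⟩
  · rintro ⟨rfl, rfl⟩
    rfl

theorem isPointOutside_gridCompl (hrt : r ≠ t) {c : Opens (EuclideanSpace ℝ (Fin d))} :
    IsPointOutside (gridCompl r t) c ↔ ∃ i j, pointCompl (gridPoint r t i j) = c := by
  constructor
  · intro h
    obtain ⟨x, rfl⟩ := isCoatom_iff_exists_pointCompl.1 h.1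
    obtain ⟨i, j, rfl⟩ := (notMem_gridCompl hrt).1 (isPointOutside_pointCompl.1 h)
    exact ⟨i, j, rfl⟩
  · rintro ⟨i, j, rfl⟩
    exact isPointOutside_pointCompl.2 ((notMem_gridCompl hrt).2 ⟨i, j, rfl⟩)

theorem isPointOutside_diagonalCompl (hrt : r ≠ t) {c : Opens (EuclideanSpace ℝ (Fin d))} :
    IsPointOutside (diagonalCompl r t) c ↔ ∃ i, pointCompl (gridPoint r t i i) = c := by
  constructor
  · intro h
    obtain ⟨x, rfl⟩ := isCoatom_iff_exists_pointCompl.1 h.1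
    obtain ⟨i, rfl⟩ := (notMem_diagonalCompl hrt).1 (isPointOutside_pointCompl.1 h)
    exact ⟨i, rfl⟩
  · rintro ⟨i, rfl⟩
    exact isPointOutside_pointCompl.2 ((notMem_diagonalCompl hrt).2 ⟨i, rfl⟩)

variable (r t) in
/-- The parameters of the interpretation, with a given code of the successor relation. -/
noncomputable def gridParams (S : Opens (EuclideanSpace ℝ (Fin d))) :
    Fin 6 → Opens (EuclideanSpace ℝ (Fin d)) :=
  ![gridCompl r t, diagonalCompl r t, strips r, strips t, S, pointCompl (gridPoint r t 0 0)]

/-- The strips for `r` compare first coordinates and those for `t` compare second coordinates, so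
the grid point `(k, l)` represents precisely the pair of numbers `k` and `l`. -/
theorem isPair_gridParams (hrt : r ≠ t) (S : Opens (EuclideanSpace ℝ (Fin d))) (i j k l : ℕ) :
    IsPair (gridParams r t S) (pointCompl (gridPoint r t i i)) (pointCompl (gridPoint r t j j))
      (pointCompl (gridPoint r t k l)) ↔ i = k ∧ j = l := by
  have h₁ := sameComponent_strips (gridPoint_left r t i i) (gridPoint_left r t k l)
  have h₂ := sameComponent_strips (gridPoint_right hrt j j) (gridPoint_right hrt k l)
  rw [← h₁, ← h₂]
  exact and_iff_right ((isPointOutside_gridCompl hrt).2 ⟨k, l, rfl⟩)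

theorem abs_natCast_sub_lt_half {i j : ℕ} : |(i : ℝ) - j| < 1 / 2 ↔ i = j := by
  constructor
  · intro h
    have h' : |(i : ℤ) - j| < 1 := by
      have : |(i : ℝ) - j| < 1 := by linarith
      exact_mod_cast this
    have := Int.abs_lt_one_iff.1 h'
    omega
  · rintro rfl
    norm_num

theorem isGrid_gridParams (hrt : r ≠ t) (S : Opens (EuclideanSpace ℝ (Fin d))) :
    IsGrid (gridParams r t S) := by
  have hnum (a : Opens (EuclideanSpace ℝ (Fin d))) :
      IsNum (gridParams r t S) a ↔ ∃ i, pointCompl (gridPoint r t i i) = a :=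
    isPointOutside_diagonalCompl hrt
  have hout (a : Opens (EuclideanSpace ℝ (Fin d))) :
      IsPointOutside (gridParams r t S 0) a ↔ ∃ i j, pointCompl (gridPoint r t i j) = a :=
    isPointOutside_gridCompl hrt
  refine ⟨?_, ?_, ?_, ?_⟩
  · exact (le_sup_left : gridCompl r t ≤ diagonalCompl r t)
  · intro c hc
    obtain ⟨i, j, rfl⟩ := (hout c).1 hc
    -- The intersection of two strips isolates `(i, j)`, since distinct natural numbers are at
    -- distance at least one.
    refine ⟨⟨{x | |x r - i| < 1 / 2} ∩ {x | |x t - j| < 1 / 2},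
      (isOpen_lt (by fun_prop) (by fun_prop)).inter (isOpen_lt (by fun_prop) (by fun_prop))⟩,
      fun c' hc' => ?_⟩
    obtain ⟨i', j', rfl⟩ := (hout c').1 hc'
    rw [not_le_pointCompl, pointCompl_injective.eq_iff, gridPoint_inj hrt,
      ← abs_natCast_sub_lt_half, ← abs_natCast_sub_lt_half (i := j')]
    change |gridPoint r t i' j' r - i| < 1 / 2 ∧ |gridPoint r t i' j' t - j| < 1 / 2 ↔ _
    rw [gridPoint_left, gridPoint_right hrt]
  · intro a ha b hb
    obtain ⟨i, rfl⟩ := (hnum a).1 ha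
    obtain ⟨j, rfl⟩ := (hnum b).1 hb
    refine ⟨pointCompl (gridPoint r t i j), (isPair_gridParams hrt S _ _ _ _).2 ⟨rfl, rfl⟩, ?_⟩
    intro a' ha' b' hb' h
    obtain ⟨i', rfl⟩ := (hnum a').1 ha'
    obtain ⟨j', rfl⟩ := (hnum b').1 hb'
    obtain ⟨rfl, rfl⟩ := (isPair_gridParams hrt S _ _ _ _).1 h
    exact ⟨rfl, rfl⟩
  · intro U
    -- Removing the off-diagonal point `(0, 1)` leaves the trace on the diagonal unchanged, and the
    -- result is not the complement of a single diagonal point.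
    refine ⟨U ⊓ pointCompl (gridPoint r t 0 1), fun h => ?_, fun a ha => ?_⟩
    · obtain ⟨i, hi⟩ := (hnum _).1 h
      have h₁ : gridPoint r t 0 1 ∉ pointCompl (gridPoint r t i i) := by
        rw [hi]
        exact fun h => mem_pointCompl.1 h.2 rfl
      rw [mem_pointCompl, not_not, gridPoint_inj hrt] at h₁
      omega
    · obtain ⟨i, rfl⟩ := (hnum a).1 ha
      have hne : gridPoint r t i i ∈ pointCompl (gridPoint r t 0 1) := by
        rw [mem_pointCompl, Ne, gridPoint_inj hrt]
        omega
      rw [le_pointCompl, le_pointCompl, ← SetLike.mem_coe, Opens.coe_inf]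
      exact not_congr (and_iff_left hne)

theorem isPeano_of_numbering {O : Type} [CompleteLattice O] {p : Fin 6 → O} {ν : ℕ → O}
    (hν : ∀ a, IsNum p a ↔ ∃ k, ν k = a) (hinj : Function.Injective ν) (hzero : p 5 = ν 0)
    (hsucc : ∀ k l, Coded p (p 4) (ν k) (ν l) ↔ l = k + 1) : IsPeano p := by
  simp only [IsPeano, hν, hzero, forall_exists_index, forall_apply_eq_imp_iff,
    exists_exists_eq_and, hsucc, hinj.eq_iff]
  refine ⟨⟨0, rfl⟩, fun k => ⟨k + 1, rfl⟩, by omega, by omega, by omega, fun U h0 h k => ?_⟩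
  induction k with
  | zero => exact h0
  | succ k ih => exact h k _ rfl ih

theorem exists_isGrid_isPeano (hrt : r ≠ t) :
    ∃ p : Fin 6 → Opens (EuclideanSpace ℝ (Fin d)), IsGrid p ∧ IsPeano p := by
  let ν (k : ℕ) : Opens (EuclideanSpace ℝ (Fin d)) := pointCompl (gridPoint r t k k)
  have hinj : Function.Injective ν := fun k l h =>
    ((gridPoint_inj hrt).1 (pointCompl_injective h)).1
  have hν (k : ℕ) : IsNum (gridParams r t ⊥) (ν k) := (isPointOutside_diagonalCompl hrt).2 ⟨k, rfl⟩
  -- Being a grid, a number or a coded pair does not involve the fourth parameter. So the code `S`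
  -- of the successor relation is found with `⊥` in that place, and `hS` remains valid after `S`
  -- replaces it.
  obtain ⟨S, hS⟩ := exists_code_numbering (isGrid_gridParams hrt ⊥) hν hinj fun k l => l = k + 1
  exact ⟨gridParams r t S, isGrid_gridParams hrt S,
    isPeano_of_numbering (fun a => isPointOutside_diagonalCompl hrt) hinj rfl hS⟩

end Grid

end OpenSetTheory

theorem theorem3p2 (n : ℕ) (hn : 2 ≤ n) :
    ManyOneEquiv
      (fun k : ℕ => k ∈ OpenSetTheory.FOOpens (EuclideanSpace ℝ (Fin n)))
      (fun k : ℕ => k ∈ OpenSetTheory.FOArith) := by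
  refine ⟨OpenSetTheory.FOOpens_manyOneReducible_FOArith n, ?_⟩
  let _ : FirstOrder.Language.order.Structure
      (TopologicalSpace.Opens (EuclideanSpace ℝ (Fin n))) :=
    FirstOrder.Language.orderStructure _
  have : FirstOrder.Language.order.OrderedStructure
      (TopologicalSpace.Opens (EuclideanSpace ℝ (Fin n))) := ⟨fun _ => Iff.rfl⟩
  -- Two distinct coordinates are needed for the grid; this is the only use of `2 ≤ n`.
  exact OpenSetTheory.FOArith_manyOneReducible (OpenSetTheory.exists_isGrid_isPeano
    (r := (⟨0, by omega⟩ : Fin n)) (t := ⟨1, by omega⟩) (by simp))
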